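/- Let $M$ be a smooth manifold of dimension $n>2$. For a smooth pseudo-Riemannian metric $g$ on $M$ let $T_i=\nabla_{\partial/\partial x^i}$ be the covariant derivatives of its Levi-Civita connection in local coordinates $x^1,\dots,x^n$, and let $\mathcal L_g\phi=T_j(g^{ij}\partial_i\phi)$ be the Laplace–Beltrami operator (divergence of the gradient). Let $R_{ij}$ and $R=g^{ij}R_{ij}$ be the Ricci tensor and scalar curvature, with the sign convention $R_{kj}=\sum_l \mathrm{Rm}^l{}_{kjl}$ where $(T_iT_j-T_jT_i)\partial_k=\sum_l\mathrm{Rm}^l{}_{kij}\,\partial_l$; this is the opposite of the convention in which round spheres have positive curvature, and it is the one for which $\mathcal L_g+\frac{n-2}{4(n-1)}R$ is conformally covariant. Define, for smooth real functions $\phi$ on $M$ (summation convention), $$\mathcal Q(g)\phi=(\mathcal L_g)^2\phi+T_j\Big[\Big(-\frac{4}{n-2}R^{ij}+\frac{n^2-4n+8}{2(n-1)(n-2)}g^{ij}R\Big)\partial_i\phi\Big]+\Big[\frac{n-4}{4(n-1)}\mathcal L_gR-\frac{n-4}{(n-2)^2}R^{ij}R_{ij}+\frac{(n-4)(n^3-4n^2+16n-16)}{16(n-1)^2(n-2)^2}R^2\Big]\phi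 .$$ Let $g_1$ and $g_2$ be two pseudo-Riemannian metrics on $M$ with $g_1=p^2g_2$ for a positive function $p$. Then for every smooth function $\phi$ on $M$, $$p^{(n+4)/2}\,\mathcal Q(g_1)\phi=\mathcal Q(g_2)\big(p^{(n-4)/2}\phi\big).$$ When $n=4$, for every pseudo-Riemannian metric $g$ on $M$ and every smooth $\phi$, $$\mathcal Q(g)\phi=(\mathcal L_g)^2\phi-2T_j\Big[\Big(R^{ij}-\tfrac13g^{ij}R\Big)\partial_i\phi\Big].$$ Moreover, when $n=4$, the kernel of the operator on smooth functions is the same for conformally related metrics: $\ker\mathcal Q(g_1)=\ker\mathcal Q(g_2)$. The conformal groups of $(M,g_1)$ and $(M,g_2)$ (all diffeomorphisms $F$ of $M$ with $F^*g_i=q^2g_i$ for some positive function $q$) coincide, and the kernel is invariant under the pointwise action $\phi\mapsto\phi\circ F^{-1}$ of this group on functions. -/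

import Mathlib

open scoped Manifold ContDiff

noncomputable section

namespace Paneitz

/-- The model space of `n`-dimensional manifolds. -/
abbrev Model (n : ℕ) := EuclideanSpace ℝ (Fin n)

/-! ### Tensor calculus in coordinates

`G : Model n → Matrix (Fin n) (Fin n) ℝ` is the matrix of components `g_{ij}` of a metric in local
coordinates, and all the functions below are meaningful on the open set where the coordinates are
defined. -/

section Coordinates

variable {n : ℕ}

/-- The partial derivative `∂_i f`. -/
def pd (i : Fin n) (f : Model n → ℝ) (y : Model n) : ℝ :=
  fderiv ℝ f y (EuclideanSpace.single i 1)

/-- The components `g^{ij}` of the inverse metric. -/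
def gUp (G : Model n → Matrix (Fin n) (Fin n) ℝ) (i j : Fin n) (y : Model n) : ℝ :=
  (G y)⁻¹ i j

/-- The Christoffel symbols `Γ^k_{ij}` of the Levi-Civita connection. -/
def christoffel (G : Model n → Matrix (Fin n) (Fin n) ℝ) (k i j : Fin n) (y : Model n) : ℝ :=
  1 / 2 * ∑ l, gUp G k l y *
    (pd i (fun z => G z j l) y + pd j (fun z => G z i l) y - pd l (fun z => G z i j) y)

/-- The components `Rm^l_{kij}` of the curvature tensor:
`T_i T_j ∂_k - T_j T_i ∂_k = ∑_l Rm^l_{kij} ∂_l`. -/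
def riemann (G : Model n → Matrix (Fin n) (Fin n) ℝ) (l k i j : Fin n) (y : Model n) : ℝ :=
  pd i (christoffel G l j k) y - pd j (christoffel G l i k) y
    + ∑ m, (christoffel G l i m y * christoffel G m j k y
      - christoffel G l j m y * christoffel G m i k y)

/-- The Ricci tensor `R_{kj} = ∑_l Rm^l_{kjl}`. The sign is the one for which the operator
`div grad + (n - 2) / (4 (n - 1)) R` is conformally covariant: it is the opposite of the convention
that makes round spheres positively curved. -/
def ricci (G : Model n → Matrix (Fin n) (Fin n) ℝ) (k j : Fin n) (y : Model n) : ℝ :=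
  ∑ l, riemann G l k j l y

/-- The Ricci tensor with raised indices, `R^{ij} = g^{ia} g^{jb} R_{ab}`. -/
def ricciUp (G : Model n → Matrix (Fin n) (Fin n) ℝ) (i j : Fin n) (y : Model n) : ℝ :=
  ∑ a, ∑ b, gUp G i a y * gUp G j b y * ricci G a b y

/-- The scalar curvature `R = g^{ij} R_{ij}`. -/
def scalarCurv (G : Model n → Matrix (Fin n) (Fin n) ℝ) (y : Model n) : ℝ :=
  ∑ i, ∑ j, gUp G i j y * ricci G i j y

/-- The square norm `R^{ij} R_{ij}` of the Ricci tensor. -/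
def ricciSq (G : Model n → Matrix (Fin n) (Fin n) ℝ) (y : Model n) : ℝ :=
  ∑ i, ∑ j, ricciUp G i j y * ricci G i j y

/-- The covariant divergence `T_j V^j = ∂_j V^j + Γ^j_{jk} V^k` of a vector field. -/
def divergence (G : Model n → Matrix (Fin n) (Fin n) ℝ) (V : Fin n → Model n → ℝ)
    (y : Model n) : ℝ :=
  ∑ j, (pd j (V j) y + ∑ k, christoffel G j j k y * V k y)

/-- The Laplace–Beltrami operator `𝓛 f = T_j (g^{ij} ∂_i f)`. -/
def laplace (G : Model n → Matrix (Fin n) (Fin n) ℝ) (f : Model n → ℝ) : Model n → ℝ :=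
  divergence G (fun j z => ∑ i, gUp G i j z * pd i f z)

/-- The coordinate expression of the quartic operator. -/
def coordQuartic (G : Model n → Matrix (Fin n) (Fin n) ℝ) (f : Model n → ℝ) (y : Model n) : ℝ :=
  laplace G (laplace G f) y
    + divergence G (fun j z => ∑ i,
        (-(4 / ((n : ℝ) - 2)) * ricciUp G i j z
          + ((n : ℝ) ^ 2 - 4 * n + 8) / (2 * ((n : ℝ) - 1) * ((n : ℝ) - 2))
            * (gUp G i j z * scalarCurv G z)) * pd i f z) y
    + (((n : ℝ) - 4) / (4 * ((n : ℝ) - 1)) * laplace G (scalarCurv G) y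
        - ((n : ℝ) - 4) / ((n : ℝ) - 2) ^ 2 * ricciSq G y
        + (((n : ℝ) - 4) * ((n : ℝ) ^ 3 - 4 * (n : ℝ) ^ 2 + 16 * n - 16))
            / (16 * ((n : ℝ) - 1) ^ 2 * ((n : ℝ) - 2) ^ 2) * scalarCurv G y ^ 2) * f y

/-- The coordinate expression `𝓛² f - 2 T_j [(R^{ij} - (1/3) g^{ij} R) ∂_i f]`. -/
def coordQuarticFour (G : Model n → Matrix (Fin n) (Fin n) ℝ) (f : Model n → ℝ)
    (y : Model n) : ℝ :=
  laplace G (laplace G f) y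
    - 2 * divergence G (fun j z => ∑ i,
        (ricciUp G i j z - 1 / 3 * (gUp G i j z * scalarCurv G z)) * pd i f z) y

end Coordinates

/-! ### Pseudo-Riemannian manifolds -/

/-- A smooth pseudo-Riemannian metric: a smooth field of nondegenerate symmetric bilinear forms on
the tangent spaces. -/
structure PseudoRiemannianMetric (n : ℕ) (M : Type*) [TopologicalSpace M]
    [ChartedSpace (Model n) M] [IsManifold 𝓘(ℝ, Model n) ∞ M] where
  /-- The bilinear form on each tangent space. -/
  inner (x : M) :
    TangentSpace 𝓘(ℝ, Model n) x →L[ℝ] TangentSpace 𝓘(ℝ, Model n) x →L[ℝ] ℝ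
  symm (x : M) (v w : TangentSpace 𝓘(ℝ, Model n) x) : inner x v w = inner x w v
  nondegenerate (x : M) (v : TangentSpace 𝓘(ℝ, Model n) x) (hv : ∀ w, inner x v w = 0) : v = 0
  contMDiff : ContMDiff 𝓘(ℝ, Model n)
    (𝓘(ℝ, Model n).prod 𝓘(ℝ, Model n →L[ℝ] Model n →L[ℝ] ℝ)) ∞
    (fun x => Bundle.TotalSpace.mk' (Model n →L[ℝ] Model n →L[ℝ] ℝ)
      (E := fun x : M => TangentSpace 𝓘(ℝ, Model n) x →L[ℝ]
        TangentSpace 𝓘(ℝ, Model n) x →L[ℝ] ℝ) x (inner x))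

section Manifold

variable {n : ℕ} {M : Type*} [TopologicalSpace M] [ChartedSpace (Model n) M]
  [IsManifold 𝓘(ℝ, Model n) ∞ M]

/-- The coordinate vector field `∂/∂x^i` of the chart `e`, at the point with coordinates `y`. -/
def coordVec (e : OpenPartialHomeomorph M (Model n)) (i : Fin n) (y : Model n) :
    TangentSpace 𝓘(ℝ, Model n) (e.symm y) :=
  mfderiv 𝓘(ℝ, Model n) 𝓘(ℝ, Model n) e.symm y (EuclideanSpace.single i (1 : ℝ) : Model n)

/-- The components `g_{ij} = g(∂/∂x^i, ∂/∂x^j)` of the metric in the chart `e`. -/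
def PseudoRiemannianMetric.components (g : PseudoRiemannianMetric n M)
    (e : OpenPartialHomeomorph M (Model n)) (y : Model n) : Matrix (Fin n) (Fin n) ℝ :=
  Matrix.of fun i j => g.inner (e.symm y) (coordVec e i y) (coordVec e j y)

/-- The quartic operator `𝓠(g)`. It is a scalar built from tensors and covariant derivatives, so it
may be evaluated at `x` in any coordinates; the preferred chart at `x` is used. -/
def quartic (g : PseudoRiemannianMetric n M) (φ : M → ℝ) (x : M) : ℝ :=
  coordQuartic (g.components (chartAt (Model n) x)) (φ ∘ (chartAt (Model n) x).symm)
    (chartAt (Model n) x x)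

/-- The operator `𝓛² φ - 2 T_j [(R^{ij} - (1/3) g^{ij} R) ∂_i φ]`. -/
def quarticFour (g : PseudoRiemannianMetric n M) (φ : M → ℝ) (x : M) : ℝ :=
  coordQuarticFour (g.components (chartAt (Model n) x)) (φ ∘ (chartAt (Model n) x).symm)
    (chartAt (Model n) x x)

/-- The kernel of the quartic operator on smooth functions. -/
def kernel (g : PseudoRiemannianMetric n M) : Set (M → ℝ) :=
  {φ | ContMDiff 𝓘(ℝ, Model n) 𝓘(ℝ) ∞ φ ∧ ∀ x, quartic g φ x = 0}

/-- The relation `g₁ = p² g₂`. -/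
def IsRescaling (p : M → ℝ) (g₁ g₂ : PseudoRiemannianMetric n M) : Prop :=
  ∀ (x : M) (v w : TangentSpace 𝓘(ℝ, Model n) x), g₁.inner x v w = p x ^ 2 * g₂.inner x v w

/-- The conformal group of `(M, g)`: the diffeomorphisms `F` of `M` such that `F^* g = q² g` for
some positive function `q`. -/
def conformalGroup (g : PseudoRiemannianMetric n M) :
    Set (M ≃ₘ⟮𝓘(ℝ, Model n), 𝓘(ℝ, Model n)⟯ M) :=
  {F | ∃ q : M → ℝ, (∀ x, 0 < q x) ∧
    ∀ (x : M) (v w : TangentSpace 𝓘(ℝ, Model n) x),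
      g.inner (F x) (mfderiv 𝓘(ℝ, Model n) 𝓘(ℝ, Model n) F x v)
        (mfderiv 𝓘(ℝ, Model n) 𝓘(ℝ, Model n) F x w) = q x ^ 2 * g.inner x v w}

end Manifold

end Paneitz

end

/-! Every assertion is a pointwise identity, so the computation takes place in the ring of germs of
smooth functions at a point. Only commuting derivations, the coordinate functions and a symmetric
matrix with its inverse are used, so tensor calculus becomes algebra over a commutative ring `A`.

The operator is built from a few invariants: the product of gradients `gam`, the Laplacian, the
contraction `ctr` of Hessians and Ricci tensors, and the scalar curvature. The contracted Bianchi
identity (`bianchi_contracted`, `div_ricUp`) turns the divergence term into such invariants, giving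
`two_mul_quartic`. The Hessian is determined by `gam` through the Koszul formula, the Laplacian is
its trace, and the Ricci tensor is the defect in the Bochner formula (`bochner`). Transformation
laws for the Ricci tensor therefore follow by comparing two Bochner formulas, and the curvature
tensor is never transformed.

For a conformal change `exp (2 s)`, the Christoffel symbols give the law of the Hessian, hence those
of the Laplacian and of the Ricci tensor. Both sides of the covariance then expand into the same
scalars. The Bochner formula and `gam_gam` remove the Laplacians and gradients of `gam s f` and `gam
s s`, and what remains is a polynomial identity with coefficients rational in `n`
(`IsConformal.quartic_eq`). For a change of coordinates every invariant is simply carried along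
(`IsPullback.quartic_eq`).

On the manifold, rescaling is studied in a single chart. Change of coordinates is needed only for a
conformal diffeomorphism, whose local expression pulls the metric back to a multiple of itself. In
dimension four the weight `(n - 4) / 2` vanishes, so the kernel is a conformal invariant. -/

noncomputable section

/-! ### Connection, curvature and Bianchi identities over a ring with commuting derivations. -/

namespace Paneitz

open Matrix Finset

/-- A commutative algebra with commuting partial derivatives `d i` and coordinates `x i`. -/
structure CoordAlgebra (n : ℕ) (A : Type*) [CommRing A] [Algebra ℝ A] where
  /-- the partial derivatives -/
  d : Fin n → Derivation ℝ A A
  d_comm : ∀ i j a, d i (d j a) = d j (d i a)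
  /-- the coordinates -/
  x : Fin n → A
  d_x : ∀ i j, d i (x j) = if i = j then 1 else 0

namespace CoordAlgebra

variable {n : ℕ} {A : Type*} [CommRing A] [Algebra ℝ A] (D : CoordAlgebra n A)

/-- The entrywise derivative of a matrix. -/
def dM (i : Fin n) (M : Matrix (Fin n) (Fin n) A) : Matrix (Fin n) (Fin n) A := M.map (D.d i)

theorem dM_apply (i : Fin n) (M : Matrix (Fin n) (Fin n) A) (a b : Fin n) :
    D.dM i M a b = D.d i (M a b) := rfl

theorem dM_mul (i : Fin n) (M N : Matrix (Fin n) (Fin n) A) :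
    D.dM i (M * N) = D.dM i M * N + M * D.dM i N := by
  ext a b
  simp only [dM_apply, Matrix.mul_apply, Matrix.add_apply, map_sum, Derivation.leibniz, smul_eq_mul,
    ← sum_add_distrib]
  exact sum_congr rfl fun k _ => by ring

theorem dM_add (i : Fin n) (M N : Matrix (Fin n) (Fin n) A) :
    D.dM i (M + N) = D.dM i M + D.dM i N := by
  ext a b; simp [dM_apply]

theorem dM_sub (i : Fin n) (M N : Matrix (Fin n) (Fin n) A) :
    D.dM i (M - N) = D.dM i M - D.dM i N := by
  ext a b; simp [dM_apply]

theorem dM_neg (i : Fin n) (M : Matrix (Fin n) (Fin n) A) :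
    D.dM i (-M) = -D.dM i M := by
  ext a b; simp [dM_apply]

theorem dM_one (i : Fin n) : D.dM i 1 = 0 := by
  ext a b; by_cases h : a = b <;> simp [dM_apply, h]

theorem dM_transpose (i : Fin n) (M : Matrix (Fin n) (Fin n) A) :
    D.dM i Mᵀ = (D.dM i M)ᵀ := rfl

theorem dM_comm (i j : Fin n) (M : Matrix (Fin n) (Fin n) A) :
    D.dM i (D.dM j M) = D.dM j (D.dM i M) := by
  ext a b; exact D.d_comm _ _ _

/-- A metric `g` with its inverse `h`. -/
structure Metric {n : ℕ} {A : Type*} [CommRing A] [Algebra ℝ A] (_D : CoordAlgebra n A) where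
  /-- the components of the metric -/
  g : Matrix (Fin n) (Fin n) A
  /-- the components of the inverse metric -/
  h : Matrix (Fin n) (Fin n) A
  g_symm : gᵀ = g
  h_symm : hᵀ = h
  g_mul_h : g * h = 1

namespace Metric

variable {D} (m : D.Metric)

theorem h_mul_g : m.h * m.g = 1 := mul_eq_one_comm.mp m.g_mul_h

theorem g_comm (i j : Fin n) : m.g i j = m.g j i := congrFun (congrFun m.g_symm j) i

theorem h_comm (i j : Fin n) : m.h i j = m.h j i := congrFun (congrFun m.h_symm j) i

/-- The Christoffel symbols. -/
def chr (k i j : Fin n) : A :=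
  (1 / 2 : ℝ) • ∑ l, m.h k l * (D.d i (m.g j l) + D.d j (m.g i l) - D.d l (m.g i j))

/-- The curvature tensor. -/
def riem (l k i j : Fin n) : A :=
  D.d i (m.chr l j k) - D.d j (m.chr l i k)
    + ∑ a, (m.chr l i a * m.chr a j k - m.chr l j a * m.chr a i k)

/-- The Ricci tensor. -/
def ric (k j : Fin n) : A := ∑ l, m.riem l k j l

/-- The Ricci tensor with raised indices. -/
def ricUp (i j : Fin n) : A := ∑ a, ∑ b, m.h i a * m.h j b * m.ric a b

/-- The scalar curvature. -/
def scal : A := ∑ i, ∑ j, m.h i j * m.ric i j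

/-- The square norm of the Ricci tensor. -/
def ricSq : A := ∑ i, ∑ j, m.ricUp i j * m.ric i j

/-- The divergence of a vector field. -/
def div (V : Fin n → A) : A := ∑ j, (D.d j (V j) + ∑ k, m.chr j j k * V k)

/-- The Laplace–Beltrami operator. -/
def lap (f : A) : A := m.div fun j => ∑ i, m.h i j * D.d i f

theorem chr_comm (k i j : Fin n) : m.chr k i j = m.chr k j i := by
  unfold chr
  congr 1
  exact sum_congr rfl fun l _ => by rw [m.g_comm i j]; ring

theorem sum_g_mul_chr (a i j : Fin n) :
    ∑ k, m.g a k * m.chr k i j =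
      (1 / 2 : ℝ) • (D.d i (m.g j a) + D.d j (m.g i a) - D.d a (m.g i j)) := by
  have key := congrFun (congrArg (fun M => M *ᵥ (fun l =>
    D.d i (m.g j l) + D.d j (m.g i l) - D.d l (m.g i j))) m.g_mul_h) a
  simp only [← mulVec_mulVec, one_mulVec] at key
  rw [← key]
  simp only [mulVec, dotProduct, chr, mul_smul_comm, ← smul_sum]

/-- Metric compatibility: in the sum of the two lowered Christoffel symbols the other derivatives of
`g` cancel in pairs. -/
theorem d_g (k i j : Fin n) :
    D.d k (m.g i j) = ∑ a, m.g j a * m.chr a k i + ∑ a, m.g i a * m.chr a k j := by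
  rw [sum_g_mul_chr, sum_g_mul_chr, m.g_comm j i, m.g_comm k i, m.g_comm k j]
  module

/-- The matrices of the connection form. -/
def conn (i : Fin n) : Matrix (Fin n) (Fin n) A := of fun l k => m.chr l i k

theorem dM_g (k : Fin n) : D.dM k m.g = m.g * m.conn k + (m.conn k)ᵀ * m.g := by
  ext i j
  rw [dM_apply, m.d_g, add_comm]
  simp only [conn, Matrix.add_apply, Matrix.mul_apply, transpose_apply, of_apply]
  congr 1
  exact sum_congr rfl fun a _ => by rw [m.g_comm j a, mul_comm]

/-- Obtained by differentiating `g * h = 1` and multiplying by `h` on the left. It says that the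
inverse metric is parallel. -/
theorem dM_h (k : Fin n) : D.dM k m.h = -(m.conn k * m.h) - m.h * (m.conn k)ᵀ := by
  have e := congrArg (D.dM k) m.g_mul_h
  rw [D.dM_mul, D.dM_one, m.dM_g] at e
  have e2 : m.h * ((m.g * m.conn k + (m.conn k)ᵀ * m.g) * m.h + m.g * D.dM k m.h) =
      (m.h * m.g) * m.conn k * m.h + m.h * (m.conn k)ᵀ * (m.g * m.h)
        + (m.h * m.g) * D.dM k m.h := by noncomm_ring
  rw [e, m.g_mul_h, m.h_mul_g] at e2
  simp only [one_mul, mul_one, mul_zero] at e2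
  rw [eq_comm, add_comm, add_eq_zero_iff_eq_neg] at e2
  rw [e2]; abel

/-- The curvature form. -/
def curv (i j : Fin n) : Matrix (Fin n) (Fin n) A :=
  D.dM i (m.conn j) - D.dM j (m.conn i) + m.conn i * m.conn j - m.conn j * m.conn i

theorem riem_eq (l k i j : Fin n) : m.riem l k i j = m.curv i j l k := by
  simp [riem, curv, conn, dM_apply, Matrix.mul_apply, sum_sub_distrib]
  ring

theorem curv_swap (i j : Fin n) : m.curv i j = -m.curv j i := by
  unfold curv; abel

/-- Since `h` is parallel, the equality of its mixed second derivatives says that the curvature acts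
on `h` by zero, which is this antisymmetry. -/
theorem curv_mul_h_antisymm (i j : Fin n) :
    (m.curv i j * m.h)ᵀ = -(m.curv i j * m.h) := by
  have e := D.dM_comm i j m.h
  simp only [m.dM_h, dM_sub, dM_neg, dM_mul, dM_transpose] at e
  rw [transpose_mul, m.h_symm]
  rw [← sub_eq_zero] at e ⊢
  rw [← neg_eq_zero, ← e]
  simp only [curv, transpose_add, transpose_sub, transpose_mul]
  noncomm_ring

/-- Torsion-freeness: after the lower indices of the Christoffel symbols are put in a common order,
the cyclic sum cancels. -/
theorem bianchi_first (i j k l : Fin n) :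
    m.curv i j l k + m.curv j k l i + m.curv k i l j = 0 := by
  simp only [curv, Matrix.sub_apply, Matrix.add_apply, dM_apply, Matrix.mul_apply, conn, of_apply]
  simp only [m.chr_comm _ k i, m.chr_comm _ k j, m.chr_comm _ j i]
  ring

/-- The curvature form with a raised index. -/
def curvUp (i j : Fin n) : Matrix (Fin n) (Fin n) A := m.curv i j * m.h

theorem curvUp_swap (i j : Fin n) : m.curvUp i j = -m.curvUp j i := by
  rw [curvUp, m.curv_swap, neg_mul, curvUp]

theorem curvUp_comm (i j a b : Fin n) : m.curvUp i j a b = -m.curvUp i j b a := by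
  have := congrFun (congrFun (m.curv_mul_h_antisymm i j) b) a
  exact this

/-- The covariant derivative of a bivector. -/
def covUp (k : Fin n) (P : Matrix (Fin n) (Fin n) A) : Matrix (Fin n) (Fin n) A :=
  D.dM k P + m.conn k * P + P * (m.conn k)ᵀ

/-- Because `h` is parallel it factors out on the right, and the rest is the Jacobi identity for the
operators `∂_i + Γ_i`. -/
theorem bianchi_second (i j k : Fin n) :
    m.covUp k (m.curvUp i j) + m.covUp i (m.curvUp j k) + m.covUp j (m.curvUp k i) = 0 := by
  have e : ∀ i j k, m.covUp k (m.curvUp i j) =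
      (D.dM k (m.curv i j) + m.conn k * m.curv i j - m.curv i j * m.conn k) * m.h := by
    intro i j k
    simp only [covUp, curvUp, dM_mul, m.dM_h]
    noncomm_ring
  rw [e, e, e, ← add_mul, ← add_mul]
  convert zero_mul m.h
  simp only [curv, dM_add, dM_sub, dM_mul]
  rw [D.dM_comm k i, D.dM_comm k j, D.dM_comm j i]
  noncomm_ring

/-- The curvature is an antisymmetric matrix times the symmetric `g`, so its trace equals its own
negative; 2 is invertible in a real algebra. -/
theorem trace_curv (i j : Fin n) : (m.curv i j).trace = 0 := by
  have e1 : m.curv i j = m.curvUp i j * m.g := by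
    rw [curvUp, mul_assoc, m.h_mul_g, mul_one]
  have e2 : (m.curv i j).trace = -(m.curv i j).trace := by
    conv_lhs => rw [e1, ← trace_transpose, transpose_mul, m.g_symm, curvUp,
      m.curv_mul_h_antisymm, mul_neg, trace_neg, trace_mul_comm, ← curvUp, ← e1]
  have e3 : (2 : ℝ) • (m.curv i j).trace = 0 := by
    rw [two_smul]; nth_rewrite 1 [e2]; simp
  have e4 := congrArg ((1 / 2 : ℝ) • ·) e3
  simpa [smul_smul] using e4

/-- Contracting the first Bianchi identity leaves the antisymmetric part of Ricci plus a trace of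
the curvature form, which vanishes. -/
theorem ric_comm (k j : Fin n) : m.ric k j = m.ric j k := by
  have e := m.trace_curv k j
  rw [trace] at e
  rw [← sub_eq_zero, ← neg_eq_zero, ← e]
  simp only [ric, riem_eq, ← sum_sub_distrib, ← sum_neg_distrib]
  refine sum_congr rfl fun l _ => ?_
  have b := m.bianchi_first j l k l
  have s' := congrFun (congrFun (m.curv_swap l k) l) j
  simp only [Matrix.neg_apply] at s'
  rw [diag_apply]
  linear_combination s' - b

end Metric
end CoordAlgebra
end Paneitz
end

/-! ### Hessians, the Bochner formula and the contracted Bianchi identity. -/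

noncomputable section

namespace Paneitz

open Matrix Finset

namespace CoordAlgebra

variable {n : ℕ} {A : Type*} [CommRing A] [Algebra ℝ A] (D : CoordAlgebra n A)

/-- The differential of a function. -/
def dv (f : A) : Fin n → A := fun i => D.d i f

/-- The entrywise derivative of a vector. -/
def dV (i : Fin n) (v : Fin n → A) : Fin n → A := fun j => D.d i (v j)

/-- The biderivation with components `T`. -/
def pair (T : Matrix (Fin n) (Fin n) A) (a b : A) : A := D.dv a ⬝ᵥ (T *ᵥ D.dv b)

theorem d_dotProduct (i : Fin n) (u v : Fin n → A) :
    D.d i (u ⬝ᵥ v) = D.dV i u ⬝ᵥ v + u ⬝ᵥ D.dV i v := by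
  simp only [dotProduct, map_sum, Derivation.leibniz, smul_eq_mul, ← sum_add_distrib, dV]
  exact sum_congr rfl fun k _ => by ring

theorem dV_mulVec (i : Fin n) (M : Matrix (Fin n) (Fin n) A) (v : Fin n → A) :
    D.dV i (M *ᵥ v) = D.dM i M *ᵥ v + M *ᵥ D.dV i v := by
  ext j
  exact D.d_dotProduct i (M j) v

theorem pair_comm {T : Matrix (Fin n) (Fin n) A} (hT : Tᵀ = T) (a b : A) :
    D.pair T a b = D.pair T b a := by
  rw [pair, dotProduct_mulVec, dotProduct_comm, ← mulVec_transpose, hT, pair]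

/-- The differentials of the coordinates are the standard basis. This is what allows tensors to be
identified by testing on functions. -/
theorem pair_x (T : Matrix (Fin n) (Fin n) A) (i j : Fin n) :
    D.pair T (D.x i) (D.x j) = T i j := by
  have e : ∀ j, D.dv (D.x j) = Pi.single j 1 := by
    intro j; ext i; simp [dv, D.d_x, Pi.single_apply]
  simp [pair, e]

theorem dV_dv_comm (i j : Fin n) (f : A) : D.dV i (D.dv f) j = D.dV j (D.dv f) i :=
  D.d_comm i j f

theorem eq_zero_of_eq_neg {y : A} (hy : y = -y) : y = 0 := by
  have e3 : (2 : ℝ) • y = 0 := by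
    rw [two_smul]; nth_rewrite 1 [hy]; simp
  simpa [smul_smul] using congrArg ((1 / 2 : ℝ) • ·) e3

namespace Metric

variable {D} (m : D.Metric)

/-- The inner product of the gradients. -/
def gam (a b : A) : A := D.pair m.h a b

/-- The Hessian. -/
def hess (f : A) : Matrix (Fin n) (Fin n) A :=
  of fun i => D.dV i (D.dv f) - (m.conn i)ᵀ *ᵥ D.dv f

/-- The Hessian with raised indices. -/
def hessUp (f : A) : Matrix (Fin n) (Fin n) A := m.h * m.hess f * m.h

/-- The full contraction of two contravariant tensors of order two. -/
def ctr (S T : Matrix (Fin n) (Fin n) A) : A := (m.g * S * m.g * T).trace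

/-- The covariant derivative of a vector field. -/
def cov (i : Fin n) (V : Fin n → A) : Fin n → A := D.dV i V + m.conn i *ᵥ V

theorem gam_comm (a b : A) : m.gam a b = m.gam b a := D.pair_comm m.h_symm a b

theorem hess_symm (f : A) : (m.hess f)ᵀ = m.hess f := by
  ext i j
  simp only [hess, transpose_apply, of_apply, Pi.sub_apply, D.dV_dv_comm j i, mulVec, dotProduct,
    conn, m.chr_comm _ i j]

theorem hessUp_symm (f : A) : (m.hessUp f)ᵀ = m.hessUp f := by
  simp only [hessUp, transpose_mul, m.hess_symm, m.h_symm, mul_assoc]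

/-- The Leibniz rule for the parallel tensor `h`: the connection terms from `dM_h` complete the
second derivatives to Hessians. -/
theorem dv_gam (f b : A) :
    D.dv (m.gam f b) = m.hess f *ᵥ (m.h *ᵥ D.dv b) + m.hess b *ᵥ (m.h *ᵥ D.dv f) := by
  ext i
  have e : ∀ u v : Fin n → A, u ⬝ᵥ (m.h *ᵥ v) = v ⬝ᵥ (m.h *ᵥ u) := by
    intro u v
    rw [dotProduct_mulVec, dotProduct_comm, ← mulVec_transpose, m.h_symm]
  have e2 : ∀ f, m.hess f i = D.dV i (D.dv f) - (m.conn i)ᵀ *ᵥ D.dv f := fun f => rfl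
  change D.d i (D.dv f ⬝ᵥ (m.h *ᵥ D.dv b)) = m.hess f i ⬝ᵥ _ + m.hess b i ⬝ᵥ _
  rw [d_dotProduct, dV_mulVec, e2, e2, m.dM_h, sub_dotProduct, sub_dotProduct, sub_mulVec,
    neg_mulVec, dotProduct_add, dotProduct_sub, dotProduct_neg, e (D.dv f) (D.dV i _),
    ← mulVec_mulVec, ← mulVec_mulVec, e (D.dv f) (_ *ᵥ _),
    mulVec_transpose (m.conn i) (D.dv f), ← dotProduct_mulVec (D.dv f)]
  ring

theorem gam_gam (a f b : A) :
    m.gam a (m.gam f b) = D.pair (m.hessUp f) a b + D.pair (m.hessUp b) a f := by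
  rw [gam, pair, m.dv_gam]
  simp only [mulVec_add, dotProduct_add, mulVec_mulVec, pair, hessUp, mul_assoc]

/-- The Koszul formula for the Hessian. -/
theorem koszul (f a b : A) :
    2 * D.pair (m.hessUp f) a b
      = m.gam a (m.gam f b) + m.gam b (m.gam f a) - m.gam f (m.gam a b) := by
  rw [gam_gam, gam_gam, gam_gam, D.pair_comm (m.hessUp_symm f) b a,
    D.pair_comm (m.hessUp_symm b) a f, D.pair_comm (m.hessUp_symm a) b f]
  ring

theorem cov_grad (i : Fin n) (f : A) : m.cov i (m.h *ᵥ D.dv f) = m.h *ᵥ m.hess f i := by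
  rw [cov, dV_mulVec, m.dM_h]
  change _ = m.h *ᵥ (D.dV i (D.dv f) - (m.conn i)ᵀ *ᵥ D.dv f)
  rw [mulVec_sub, sub_mulVec, neg_mulVec, mulVec_mulVec, mulVec_mulVec]
  abel

theorem cov_grad_apply (i j : Fin n) (f : A) :
    m.cov i (m.h *ᵥ D.dv f) j = (m.hess f * m.h) i j := by
  rw [m.cov_grad, mulVec, dotProduct_comm, Matrix.mul_apply, dotProduct]
  exact sum_congr rfl fun k _ => by rw [m.h_comm j k]

theorem div_eq (V : Fin n → A) : m.div V = ∑ j, m.cov j V j := rfl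

theorem lap_eq_div (f : A) : m.lap f = m.div (m.h *ᵥ D.dv f) := by
  unfold lap
  congr 1
  ext j
  exact sum_congr rfl fun i _ => by rw [m.h_comm i j]; rfl

/-- The covariant derivative of the gradient is the Hessian with one index raised. In trace form the
Laplacian inherits its transformation laws from the Hessian. -/
theorem lap_eq (f : A) : m.lap f = (m.g * m.hessUp f).trace := by
  have e : (m.g * m.hessUp f).trace = (m.hess f * m.h).trace := by
    rw [hessUp, ← mul_assoc, ← mul_assoc, m.g_mul_h, one_mul]
  rw [e, lap_eq_div, div_eq]
  exact sum_congr rfl fun j _ => m.cov_grad_apply j j f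

/-- The Ricci identity; `cov` acts only on the vector index, and the derivatives commute, so no
further Christoffel term appears. -/
theorem cov_cov (i j : Fin n) (V : Fin n → A) :
    m.cov j (m.cov i V) = m.cov i (m.cov j V) + m.curv j i *ᵥ V := by
  have e : D.dV j (D.dV i V) = D.dV i (D.dV j V) := by
    ext k; exact D.d_comm _ _ _
  have e2 : ∀ i (u v : Fin n → A), D.dV i (u + v) = D.dV i u + D.dV i v := by
    intro i u v; ext k; simp [dV]
  simp only [cov, e2, dV_mulVec, curv, add_mulVec, sub_mulVec, mulVec_add, mulVec_mulVec, e]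
  abel

/-- The divergence of the covariant derivative of `V` along `W`. -/
theorem div_cov (V W : Fin n → A) :
    m.div (fun j => ∑ i, W i * m.cov i V j)
      = ∑ j, ∑ i, m.cov j W i * m.cov i V j + ∑ i, W i * D.d i (m.div V)
        - ∑ i, ∑ k, m.ric k i * (W i * V k) := by
  have h1 : m.div (fun j => ∑ i, W i * m.cov i V j)
      = ∑ j, ∑ i, (D.d j (W i) * m.cov i V j + W i * m.cov j (m.cov i V) j) := by
    refine sum_congr rfl fun j _ => ?_
    have : ∑ k, m.chr j j k * ∑ i, W i * m.cov i V k
        = ∑ i, W i * (m.conn j *ᵥ m.cov i V) j := by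
      simp only [mul_sum, mulVec, dotProduct]
      rw [sum_comm]
      exact sum_congr rfl fun i _ => sum_congr rfl fun k _ => by
        simp only [conn, of_apply]; ring
    rw [this, map_sum, ← sum_add_distrib]
    refine sum_congr rfl fun i _ => ?_
    rw [show m.cov j (m.cov i V) j = D.d j (m.cov i V j) + (m.conn j *ᵥ m.cov i V) j from rfl,
      Derivation.leibniz, smul_eq_mul, smul_eq_mul]
    ring
  -- `cov i` ignores the lower index `j`, so contraction leaves a Christoffel term. The same term
  -- appears in `h4`, from the covariant derivative of `W`, and the two cancel.
  have h2 : ∀ i, ∑ j, m.cov i (m.cov j V) j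
      = D.d i (m.div V) + ∑ j, ∑ k, m.chr j i k * m.cov j V k := by
    intro i
    rw [div_eq, map_sum, ← sum_add_distrib]
    exact sum_congr rfl fun j _ => rfl
  have h3 : ∀ i, ∑ j, (m.curv j i *ᵥ V) j = - ∑ k, m.ric k i * V k := by
    intro i
    simp only [mulVec, dotProduct, ric, sum_mul, ← sum_neg_distrib]
    rw [sum_comm]
    refine sum_congr rfl fun k _ => sum_congr rfl fun j _ => ?_
    rw [m.riem_eq, m.curv_swap j i, Matrix.neg_apply, neg_mul]
  have h4 : ∑ j, ∑ i, m.cov j W i * m.cov i V j = ∑ j, ∑ i, D.d j (W i) * m.cov i V j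
      + ∑ i, W i * ∑ j, ∑ k, m.chr j i k * m.cov j V k := by
    have : ∑ i, W i * ∑ j, ∑ k, m.chr j i k * m.cov j V k
        = ∑ j, ∑ i, ∑ k, m.chr i j k * W k * m.cov i V j := by
      simp only [mul_sum]
      calc _ = ∑ j, ∑ k, ∑ i, W i * (m.chr j i k * m.cov j V k) := by
            rw [sum_comm]; exact sum_congr rfl fun j _ => sum_comm
        _ = _ := by
            rw [sum_comm]
            exact sum_congr rfl fun k _ => sum_congr rfl fun j _ => sum_congr rfl fun i _ => by
              rw [m.chr_comm j i k]; ring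
    rw [this, ← sum_add_distrib]
    refine sum_congr rfl fun j _ => ?_
    rw [← sum_add_distrib]
    refine sum_congr rfl fun i _ => ?_
    rw [cov, Pi.add_apply, add_mul, ← sum_mul]
    rfl
  rw [h1, h4]
  have h0 : ∀ i j, m.cov j (m.cov i V) j = m.cov i (m.cov j V) j + (m.curv j i *ᵥ V) j := by
    intro i j; rw [cov_cov]; rfl
  simp only [h0, sum_add_distrib, mul_add]
  have h5 : ∑ j, ∑ i, W i * m.cov i (m.cov j V) j
      = ∑ i, W i * D.d i (m.div V) + ∑ i, W i * ∑ j, ∑ k, m.chr j i k * m.cov j V k := by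
    rw [sum_comm]
    simp only [← mul_sum, h2, mul_add, sum_add_distrib]
  have h6 : ∑ j, ∑ i, W i * (m.curv j i *ᵥ V) j = - ∑ i, ∑ k, m.ric k i * (W i * V k) := by
    rw [sum_comm]
    simp only [← mul_sum, h3, ← sum_neg_distrib]
    refine sum_congr rfl fun i _ => ?_
    simp only [mul_sum, sum_neg_distrib, mul_neg]
    congr 1
    exact sum_congr rfl fun k _ => by ring
  rw [h5, h6]
  ring

/-- The matrix of the Ricci tensor with raised indices. -/
def ricUpM : Matrix (Fin n) (Fin n) A := m.h * of m.ric * m.h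

theorem ricUp_eq (i j : Fin n) : m.ricUp i j = m.ricUpM i j := by
  simp only [ricUp, ricUpM, Matrix.mul_apply, of_apply, sum_mul]
  rw [sum_comm]
  exact sum_congr rfl fun a _ => sum_congr rfl fun b _ => by rw [m.h_comm a j]; ring

theorem ricM_symm : (of m.ric)ᵀ = of m.ric := by
  ext i j; exact m.ric_comm j i

theorem ricUpM_symm : m.ricUpMᵀ = m.ricUpM := by
  simp only [ricUpM, transpose_mul, m.ricM_symm, m.h_symm, mul_assoc]

theorem ctr_comm (S T : Matrix (Fin n) (Fin n) A) : m.ctr S T = m.ctr T S := by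
  rw [ctr, ctr, mul_assoc, trace_mul_comm, ← mul_assoc]

theorem ctr_up_left (S T : Matrix (Fin n) (Fin n) A) :
    m.ctr (m.h * S * m.h) T = (S * T).trace := by
  rw [ctr, ← mul_assoc, ← mul_assoc, m.g_mul_h, one_mul, mul_assoc S, m.h_mul_g, mul_one]

theorem scal_eq : m.scal = (m.g * m.ricUpM).trace := by
  have e : (m.g * m.ricUpM).trace = (of m.ric * m.h).trace := by
    rw [ricUpM, ← mul_assoc, ← mul_assoc, m.g_mul_h, one_mul]
  rw [e, scal, trace]
  simp only [diag_apply, Matrix.mul_apply, of_apply]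
  exact sum_congr rfl fun i _ => sum_congr rfl fun j _ => by rw [m.h_comm i j, mul_comm]

theorem ricSq_eq : m.ricSq = m.ctr m.ricUpM m.ricUpM := by
  nth_rewrite 1 [ricUpM]
  rw [ctr_up_left, ricSq, trace]
  simp only [diag_apply, Matrix.mul_apply, of_apply, ricUp_eq]
  refine sum_congr rfl fun i _ => sum_congr rfl fun j _ => ?_
  rw [mul_comm]
  congr 1
  exact congrFun (congrFun m.ricUpM_symm j) i

/-- This is `div_cov` for two gradients, half of the Bochner formula: the gradient of `gam a b` is a
sum of two such fields. -/
theorem div_hessUp (a b : A) :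
    m.div (m.hessUp a *ᵥ D.dv b)
      = m.ctr (m.hessUp a) (m.hessUp b) + m.gam (m.lap a) b - D.pair m.ricUpM a b := by
  have e := m.div_cov (m.h *ᵥ D.dv a) (m.h *ᵥ D.dv b)
  have e1 : (fun j => ∑ i, (m.h *ᵥ D.dv b) i * m.cov i (m.h *ᵥ D.dv a) j)
      = m.hessUp a *ᵥ D.dv b := by
    have : m.hessUp a = (m.hess a * m.h)ᵀ * m.h := by
      rw [transpose_mul, m.h_symm, m.hess_symm, hessUp]
    ext j
    rw [this, ← mulVec_mulVec, mulVec_transpose]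
    simp only [cov_grad_apply]
    rfl
  have e2 : ∑ j, ∑ i, m.cov j (m.h *ᵥ D.dv b) i * m.cov i (m.h *ᵥ D.dv a) j
      = m.ctr (m.hessUp a) (m.hessUp b) := by
    rw [ctr_comm, show m.hessUp b = m.h * m.hess b * m.h from rfl, ctr_up_left, hessUp, ← mul_assoc, ← mul_assoc]
    simp only [cov_grad_apply]
    rw [mul_assoc]
    rfl
  have e3 : ∑ i, (m.h *ᵥ D.dv b) i * D.d i (m.div (m.h *ᵥ D.dv a)) = m.gam (m.lap a) b := by
    rw [m.gam_comm, gam, pair, dotProduct_mulVec, ← mulVec_transpose, m.h_symm, ← lap_eq_div]; rfl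
  have e4 : ∑ i, ∑ k, m.ric k i * ((m.h *ᵥ D.dv b) i * (m.h *ᵥ D.dv a) k)
      = D.pair m.ricUpM a b := by
    rw [pair, ricUpM, mul_assoc, ← mulVec_mulVec, dotProduct_mulVec, ← mulVec_transpose,
      m.h_symm, ← mulVec_mulVec]
    generalize m.h *ᵥ D.dv b = W
    generalize m.h *ᵥ D.dv a = V
    simp only [dotProduct, mulVec, mul_sum, of_apply]
    rw [sum_comm]
    exact sum_congr rfl fun i _ => sum_congr rfl fun j _ => by ring
  rw [← e1, e, e2, e3, e4]

theorem div_add (V W : Fin n → A) : m.div (V + W) = m.div V + m.div W := by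
  simp only [div, Pi.add_apply, map_add, mul_add, sum_add_distrib]; ring

/-- The Bochner formula. -/
theorem bochner (a b : A) :
    m.lap (m.gam a b) = m.gam a (m.lap b) + m.gam b (m.lap a)
      + 2 * m.ctr (m.hessUp a) (m.hessUp b) - 2 * D.pair m.ricUpM a b := by
  rw [lap_eq_div, dv_gam, mulVec_add, div_add]
  have e : ∀ a b, m.h *ᵥ (m.hess a *ᵥ (m.h *ᵥ D.dv b)) = m.hessUp a *ᵥ D.dv b := by
    intro a b; simp only [mulVec_mulVec, hessUp, mul_assoc]
  rw [e, e, div_hessUp, div_hessUp, m.ctr_comm (m.hessUp b), D.pair_comm m.ricUpM_symm b a,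
    m.gam_comm a, m.gam_comm b]
  ring

theorem ric_mixed (a i : Fin n) : (m.h * of m.ric) a i = ∑ l, m.curvUp i l l a := by
  simp only [Matrix.mul_apply, of_apply, ric, riem_eq, curvUp, mul_sum]
  rw [sum_comm]
  exact sum_congr rfl fun l _ => sum_congr rfl fun k _ => by rw [m.h_comm a k, mul_comm]

theorem curvUp_transpose (i j : Fin n) : (m.curvUp i j)ᵀ = m.curvUp j i := by
  rw [curvUp, curv_mul_h_antisymm, ← curvUp, ← curvUp_swap]

theorem covUp_transpose (k : Fin n) (P : Matrix (Fin n) (Fin n) A) :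
    m.covUp k Pᵀ = (m.covUp k P)ᵀ := by
  simp only [covUp, transpose_add, transpose_mul, dM_transpose, transpose_transpose]
  abel

/-- The contracted Bianchi identity. -/
theorem bianchi_contracted (i : Fin n) :
    2 * ∑ j, (D.dM j (m.h * of m.ric) + m.conn j * (m.h * of m.ric)
      - (m.h * of m.ric) * m.conn j) j i = D.d i m.scal := by
  set S := m.h * of m.ric with hS
  -- Double contraction of the second Bianchi identity. The first and third terms agree and give the
  -- divergence of Ricci; the middle one gives the derivative of the scalar curvature. `covUp`
  -- ignores the form indices, and the Christoffel terms left over are those of the lower index `i`.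
  have h0 : ∑ a, ∑ l, (m.covUp a (m.curvUp i l) l a + m.covUp i (m.curvUp l a) l a
      + m.covUp l (m.curvUp a i) l a) = 0 :=
    sum_eq_zero fun a _ => sum_eq_zero fun l _ =>
      congrFun (congrFun (m.bianchi_second i l a) l) a
  have h3 : ∑ a, ∑ l, m.covUp l (m.curvUp a i) l a = ∑ a, ∑ l, m.covUp a (m.curvUp i l) l a := by
    rw [sum_comm]
    refine sum_congr rfl fun l _ => sum_congr rfl fun a _ => ?_
    rw [← m.curvUp_transpose i a, covUp_transpose, transpose_apply]
  -- A sum of a symmetric symbol against an antisymmetric curvature.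
  have hmid : ∀ l, ∑ a, ∑ b, m.chr l a b * m.curvUp i l b a = 0 := by
    intro l
    apply eq_zero_of_eq_neg
    conv_lhs => rw [sum_comm]
    simp only [← sum_neg_distrib]
    refine sum_congr rfl fun a _ => sum_congr rfl fun b _ => ?_
    rw [m.chr_comm l b a, m.curvUp_comm i l a b]; ring
  have h1 : ∑ a, ∑ l, m.covUp a (m.curvUp i l) l a
      = ∑ a, (D.d a (S a i) + ∑ b, m.chr a a b * S b i) := by
    have : ∀ a l, m.covUp a (m.curvUp i l) l a = D.d a (m.curvUp i l l a)
        + ∑ b, m.chr l a b * m.curvUp i l b a + ∑ b, m.chr a a b * m.curvUp i l l b := by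
      intro a l
      simp only [covUp, Matrix.add_apply, Matrix.mul_apply, transpose_apply, dM_apply, conn,
        of_apply]
      congr 1
      exact sum_congr rfl fun b _ => mul_comm _ _
    simp only [this, sum_add_distrib]
    rw [sum_comm (f := fun a l => ∑ b, m.chr l a b * m.curvUp i l b a)]
    simp only [hmid, sum_const_zero, add_zero, hS, ric_mixed, map_sum, mul_sum]
    congr 1
    exact sum_congr rfl fun a _ => sum_comm
  have h2 : ∑ a, ∑ l, m.covUp i (m.curvUp l a) l a
      = - D.d i m.scal - 2 * ∑ a, ∑ b, m.chr a i b * S b a := by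
    have e : ∀ a l, m.covUp i (m.curvUp l a) l a = - D.d i (m.curvUp l a a l)
        - ∑ b, m.chr l i b * m.curvUp l a a b - ∑ b, m.chr a i b * m.curvUp a l l b := by
      intro a l
      simp only [covUp, Matrix.add_apply, Matrix.mul_apply, transpose_apply, dM_apply, conn,
        of_apply, sub_eq_add_neg, ← sum_neg_distrib]
      congr 1
      · congr 1
        · rw [m.curvUp_comm l a l a, map_neg]
        · exact sum_congr rfl fun b _ => by rw [m.curvUp_comm l a b a]; ring
      · exact sum_congr rfl fun b _ => by
          rw [m.curvUp_swap l a, Matrix.neg_apply]; ring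
    have es : m.scal = ∑ l, ∑ a, m.curvUp l a a l := by
      rw [scal]
      refine sum_congr rfl fun l _ => ?_
      rw [← ric_mixed, Matrix.mul_apply]
      exact sum_congr rfl fun j _ => by rw [of_apply, m.ric_comm]
    have e5 : ∑ a, ∑ l, ∑ b, m.chr l i b * m.curvUp l a a b = ∑ a, ∑ b, m.chr a i b * S b a := by
      rw [sum_comm]
      refine sum_congr rfl fun l _ => ?_
      rw [sum_comm]
      simp only [hS, ric_mixed, mul_sum]
    have e6 : ∑ a, ∑ l, ∑ b, m.chr a i b * m.curvUp a l l b = ∑ a, ∑ b, m.chr a i b * S b a := by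
      refine sum_congr rfl fun l _ => ?_
      rw [sum_comm]
      simp only [hS, ric_mixed, mul_sum]
    simp only [e, sum_sub_distrib, sum_neg_distrib, e5, e6, es, map_sum]
    rw [sum_comm]
    ring
  have h4 : ∑ j, (D.dM j S + m.conn j * S - S * m.conn j) j i
      = ∑ a, (D.d a (S a i) + ∑ b, m.chr a a b * S b i) - ∑ a, ∑ b, m.chr a i b * S b a := by
    rw [sum_comm (f := fun a b => m.chr a i b * S b a), ← sum_sub_distrib]
    refine sum_congr rfl fun j _ => ?_
    simp only [Matrix.sub_apply, Matrix.add_apply, Matrix.mul_apply, dM_apply, conn, of_apply]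
    congr 1
    exact sum_congr rfl fun b _ => by rw [m.chr_comm b i j]; ring
  simp only [sum_add_distrib (f := fun a => ∑ l, _), sum_add_distrib (f := fun _ => _ + _),
    sum_add_distrib] at h0
  rw [h4]
  simp only [sum_add_distrib] at h0 h1 h2 h3 ⊢
  linear_combination h0 - h2 - h3 - 2 * h1

/-- The divergence of the Ricci tensor applied to a gradient. -/
theorem div_ricUp (f : A) :
    2 * m.div (m.ricUpM *ᵥ D.dv f)
      = m.gam m.scal f + 2 * m.ctr m.ricUpM (m.hessUp f) := by
  set S := m.h * of m.ric with hS
  have e0 : m.ricUpM *ᵥ D.dv f = S *ᵥ (m.h *ᵥ D.dv f) := by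
    rw [mulVec_mulVec]; rfl
  set W := m.h *ᵥ D.dv f with hW
  have e1 : ∀ j, m.cov j (S *ᵥ W)
      = S *ᵥ m.cov j W + (D.dM j S + m.conn j * S - S * m.conn j) *ᵥ W := by
    intro j
    simp only [cov, dV_mulVec, mulVec_add, add_mulVec, sub_mulVec, mulVec_mulVec]
    abel
  have e2 : ∑ j, (S *ᵥ m.cov j W) j = m.ctr m.ricUpM (m.hessUp f) := by
    rw [ricUpM, ctr_up_left, hessUp, trace_mul_comm, mul_assoc (m.h * m.hess f), ← hS,
      trace_mul_comm, trace]
    refine sum_congr rfl fun j _ => ?_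
    rw [diag_apply, Matrix.mul_apply, mulVec, dotProduct]
    refine sum_congr rfl fun i _ => ?_
    rw [hW, cov_grad_apply, ← m.hess_symm, ← transpose_apply (_ * _), transpose_mul, m.h_symm,
      transpose_transpose, m.hess_symm]
  have e3 : 2 * ∑ j, ((D.dM j S + m.conn j * S - S * m.conn j) *ᵥ W) j = m.gam m.scal f := by
    rw [gam, pair]
    simp only [mulVec, dotProduct]
    rw [sum_comm, mul_sum]
    refine sum_congr rfl fun i _ => ?_
    rw [← sum_mul, ← mul_assoc, m.bianchi_contracted i]
    rfl
  rw [e0, div_eq]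
  simp only [e1, Pi.add_apply, sum_add_distrib, mul_add, e2, e3]
  ring

end Metric
end CoordAlgebra
end Paneitz
end

/-! ### Rules of calculus and the quartic operator in terms of scalar invariants. -/

noncomputable section

namespace Paneitz

open Matrix Finset

namespace CoordAlgebra

variable {n : ℕ} {A : Type*} [CommRing A] [Algebra ℝ A] (D : CoordAlgebra n A)

theorem two_mul_cancel {a b : A} (h : 2 * a = 2 * b) : a = b := by
  have : a - b = 0 := eq_zero_of_eq_neg (by linear_combination h)
  exact sub_eq_zero.mp this

theorem dv_add (a b : A) : D.dv (a + b) = D.dv a + D.dv b := by ext i; simp [dv]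

theorem dv_sub (a b : A) : D.dv (a - b) = D.dv a - D.dv b := by ext i; simp [dv]

theorem dv_mul (a b : A) : D.dv (a * b) = a • D.dv b + b • D.dv a := by ext i; simp [dv]

theorem pair_add (S T : Matrix (Fin n) (Fin n) A) (a b : A) :
    D.pair (S + T) a b = D.pair S a b + D.pair T a b := by
  simp [pair, add_mulVec]

theorem pair_sub (S T : Matrix (Fin n) (Fin n) A) (a b : A) :
    D.pair (S - T) a b = D.pair S a b - D.pair T a b := by
  simp [pair, sub_mulVec]

theorem pair_smul (c : A) (T : Matrix (Fin n) (Fin n) A) (a b : A) :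
    D.pair (c • T) a b = c * D.pair T a b := by
  simp [pair, smul_mulVec]

theorem ext_of_pair {S T : Matrix (Fin n) (Fin n) A} (h : ∀ a b, D.pair S a b = D.pair T a b) :
    S = T := by
  ext i j
  rw [← D.pair_x S, h, D.pair_x]

namespace Metric

variable {D} (m : D.Metric)

theorem gam_add_left (a b c : A) : m.gam (a + b) c = m.gam a c + m.gam b c := by
  simp [gam, pair, dv_add]

theorem gam_add_right (a b c : A) : m.gam c (a + b) = m.gam c a + m.gam c b := by
  rw [gam_comm, gam_add_left, m.gam_comm a, m.gam_comm b]

theorem gam_mul_left (a b c : A) : m.gam (a * b) c = a * m.gam b c + b * m.gam a c := by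
  simp [gam, pair, dv_mul]

theorem gam_mul_right (a b c : A) : m.gam c (a * b) = a * m.gam c b + b * m.gam c a := by
  rw [gam_comm, gam_mul_left, m.gam_comm a, m.gam_comm b]

/-- The ring `A` has no exponentials or logarithms. Powers of the conformal factor enter only
through relations `dv v = c • dv s` of this kind. -/
theorem gam_of_dv {v s c : A} (hv : D.dv v = c • D.dv s) (a : A) :
    m.gam v a = c * m.gam s a := by
  simp [gam, pair, hv]

theorem gam_of_dv_right {v s c : A} (hv : D.dv v = c • D.dv s) (a : A) :
    m.gam a v = c * m.gam a s := by
  rw [gam_comm, m.gam_of_dv hv, m.gam_comm]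

theorem gam_const {k : A} (hk : D.dv k = 0) (a : A) : m.gam k a = 0 := by
  simp [gam, pair, hk]

theorem div_smul (f : A) (V : Fin n → A) : m.div (f • V) = f * m.div V + V ⬝ᵥ D.dv f := by
  simp only [div, dotProduct, mul_sum, ← sum_add_distrib, Pi.smul_apply, smul_eq_mul,
    Derivation.leibniz, mul_add, dv]
  refine sum_congr rfl fun j _ => ?_
  rw [add_right_comm]
  congr 2
  exact sum_congr rfl fun k _ => by ring

theorem grad_dot (a b : A) : (m.h *ᵥ D.dv a) ⬝ᵥ D.dv b = m.gam a b := by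
  rw [m.gam_comm, gam, pair, dotProduct_comm]

theorem lap_add (a b : A) : m.lap (a + b) = m.lap a + m.lap b := by
  simp only [lap_eq_div, dv_add, mulVec_add, div_add]

theorem lap_mul (a b : A) : m.lap (a * b) = a * m.lap b + b * m.lap a + 2 * m.gam a b := by
  simp only [lap_eq_div, dv_mul, mulVec_add, mulVec_smul, div_add, div_smul, grad_dot,
    m.gam_comm b a]
  ring

theorem lap_const {k : A} (hk : D.dv k = 0) : m.lap k = 0 := by
  rw [lap_eq_div, hk]; simp [div]

theorem lap_of_dv {v s c : A} (hv : D.dv v = c • D.dv s) :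
    m.lap v = c * m.lap s + m.gam s c := by
  rw [lap_eq_div, hv, mulVec_smul, div_smul, grad_dot, lap_eq_div]

theorem lap_const_mul {k : A} (hk : D.dv k = 0) (a : A) : m.lap (k * a) = k * m.lap a := by
  rw [lap_mul, m.lap_const hk, m.gam_const hk]; ring

theorem gam_const_mul_left {k : A} (hk : D.dv k = 0) (a b : A) :
    m.gam (k * a) b = k * m.gam a b := by
  rw [gam_mul_left, m.gam_const hk]; ring

theorem gam_const_mul_right {k : A} (hk : D.dv k = 0) (a b : A) :
    m.gam a (k * b) = k * m.gam a b := by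
  rw [gam_comm, m.gam_const_mul_left hk, m.gam_comm]

theorem dv_algebraMap (D : CoordAlgebra n A) (c : ℝ) : D.dv (algebraMap ℝ A c) = 0 := by
  ext i; simp [dv]

theorem dv_natCast (D : CoordAlgebra n A) (k : ℕ) : D.dv (k : A) = 0 := by
  ext i; simp [dv]

/-- The product of the gradients of two functions. -/
def outer (a b : A) : Matrix (Fin n) (Fin n) A :=
  m.h * vecMulVec (D.dv a) (D.dv b) * m.h

theorem ctr_add_left (S T U : Matrix (Fin n) (Fin n) A) :
    m.ctr (S + T) U = m.ctr S U + m.ctr T U := by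
  simp [ctr, mul_add, add_mul]

theorem ctr_sub_left (S T U : Matrix (Fin n) (Fin n) A) :
    m.ctr (S - T) U = m.ctr S U - m.ctr T U := by
  simp [ctr, mul_sub, sub_mul]

theorem ctr_smul_left (c : A) (S U : Matrix (Fin n) (Fin n) A) :
    m.ctr (c • S) U = c * m.ctr S U := by
  simp [ctr]

theorem ctr_add_right (S T U : Matrix (Fin n) (Fin n) A) :
    m.ctr U (S + T) = m.ctr U S + m.ctr U T := by
  simp [ctr, mul_add]

theorem ctr_sub_right (S T U : Matrix (Fin n) (Fin n) A) :
    m.ctr U (S - T) = m.ctr U S - m.ctr U T := by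
  simp [ctr, mul_sub]

theorem ctr_smul_right (c : A) (S U : Matrix (Fin n) (Fin n) A) :
    m.ctr U (c • S) = c * m.ctr U S := by
  simp [ctr]

theorem ctr_outer_left (a b : A) (T : Matrix (Fin n) (Fin n) A) :
    m.ctr (m.outer a b) T = D.pair T b a := by
  rw [outer, ctr_up_left, vecMulVec_mul, trace_vecMulVec, pair, dotProduct_mulVec,
    dotProduct_comm]

theorem ctr_outer_right (a b : A) (T : Matrix (Fin n) (Fin n) A) :
    m.ctr T (m.outer a b) = D.pair T b a := by
  rw [ctr_comm, ctr_outer_left]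

theorem ctr_h_left (T : Matrix (Fin n) (Fin n) A) : m.ctr m.h T = (m.g * T).trace := by
  rw [ctr, m.g_mul_h, one_mul]

theorem ctr_h_right (T : Matrix (Fin n) (Fin n) A) : m.ctr T m.h = (m.g * T).trace := by
  rw [ctr_comm, ctr_h_left]

theorem trace_g_mul_h : (m.g * m.h).trace = (n : A) := by
  rw [m.g_mul_h, trace_one, Fintype.card_fin]

theorem trace_g_mul_outer (a b : A) : (m.g * m.outer a b).trace = m.gam a b := by
  rw [← ctr_h_right, ctr_outer_left, m.gam_comm, gam]

theorem pair_outer (a b x y : A) : D.pair (m.outer a b) x y = m.gam a x * m.gam b y := by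
  rw [pair, outer, mul_assoc, ← mulVec_mulVec, ← mulVec_mulVec, vecMulVec_mulVec,
    m.gam_comm a x, gam, gam, pair, pair]
  simp [mulVec_smul, mul_comm]

theorem hessUp_mul (u f : A) :
    m.hessUp (u * f) = u • m.hessUp f + f • m.hessUp u + m.outer u f + m.outer f u := by
  have e : m.hess (u * f) = u • m.hess f + f • m.hess u + vecMulVec (D.dv u) (D.dv f)
      + vecMulVec (D.dv f) (D.dv u) := by
    ext i j
    simp only [hess, dv_mul, of_apply, Matrix.add_apply, Matrix.smul_apply, vecMulVec_apply,
      Pi.sub_apply, smul_eq_mul, mulVec_add, mulVec_smul, Pi.add_apply, Pi.smul_apply, dV, map_add,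
      Derivation.leibniz]
    simp only [dv]
    ring
  simp only [hessUp, e, outer, mul_add, add_mul, Matrix.mul_smul, Matrix.smul_mul]

/-- The model is `u = exp (c s)` with `c` constant. -/
theorem hessUp_of_dv {u s c : A} (hu : D.dv u = (c * u) • D.dv s) (hc : D.dv c = 0) :
    m.hessUp u = (c * u) • (m.hessUp s + c • m.outer s s) := by
  have e : m.hess u = (c * u) • (m.hess s + c • vecMulVec (D.dv s) (D.dv s)) := by
    ext i j
    have h1 : D.d i u = c * u * D.d i s := congrFun hu i
    have h2 : D.d i c = 0 := congrFun hc i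
    simp only [hess, hu, of_apply, Matrix.add_apply, Matrix.smul_apply, vecMulVec_apply,
      Pi.sub_apply, smul_eq_mul, mulVec_smul, Pi.smul_apply, dV, Derivation.leibniz, h1, h2]
    simp only [dv]
    ring
  simp only [hessUp, e, outer, mul_add, add_mul, Matrix.mul_smul, Matrix.smul_mul, smul_add]

/-- The quartic operator. -/
def quartic (f : A) : A :=
  m.lap (m.lap f)
    + m.div (fun j => ∑ i,
        (algebraMap ℝ A (-(4 / ((n : ℝ) - 2))) * m.ricUp i j
          + algebraMap ℝ A (((n : ℝ) ^ 2 - 4 * n + 8) / (2 * ((n : ℝ) - 1) * ((n : ℝ) - 2)))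
            * (m.h i j * m.scal)) * D.d i f)
    + (algebraMap ℝ A (((n : ℝ) - 4) / (4 * ((n : ℝ) - 1))) * m.lap m.scal
        - algebraMap ℝ A (((n : ℝ) - 4) / ((n : ℝ) - 2) ^ 2) * m.ricSq
        + algebraMap ℝ A ((((n : ℝ) - 4) * ((n : ℝ) ^ 3 - 4 * (n : ℝ) ^ 2 + 16 * n - 16))
            / (16 * ((n : ℝ) - 1) ^ 2 * ((n : ℝ) - 2) ^ 2)) * m.scal ^ 2) * f

theorem div_const_smul {k : A} (hk : D.dv k = 0) (V : Fin n → A) :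
    m.div (k • V) = k * m.div V := by
  rw [div_smul, hk, dotProduct_zero, add_zero]

/-- All divergences are carried out, so that only invariants with known transformation laws remain.
The factor 2 comes from `div_ricUp`. -/
theorem two_mul_quartic (f : A) :
    2 * m.quartic f = 2 * m.lap (m.lap f)
      + algebraMap ℝ A (-(4 / ((n : ℝ) - 2))) * (m.gam m.scal f + 2 * m.ctr m.ricUpM (m.hessUp f))
      + 2 * algebraMap ℝ A (((n : ℝ) ^ 2 - 4 * n + 8) / (2 * ((n : ℝ) - 1) * ((n : ℝ) - 2)))
          * (m.scal * m.lap f + m.gam m.scal f)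
      + 2 * (algebraMap ℝ A (((n : ℝ) - 4) / (4 * ((n : ℝ) - 1))) * m.lap m.scal
        - algebraMap ℝ A (((n : ℝ) - 4) / ((n : ℝ) - 2) ^ 2) * m.ctr m.ricUpM m.ricUpM
        + algebraMap ℝ A ((((n : ℝ) - 4) * ((n : ℝ) ^ 3 - 4 * (n : ℝ) ^ 2 + 16 * n - 16))
            / (16 * ((n : ℝ) - 1) ^ 2 * ((n : ℝ) - 2) ^ 2)) * m.scal ^ 2) * f := by
  rw [quartic]
  set c := algebraMap ℝ A (-(4 / ((n : ℝ) - 2))) with hc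
  set c' := algebraMap ℝ A (((n : ℝ) ^ 2 - 4 * n + 8) / (2 * ((n : ℝ) - 1) * ((n : ℝ) - 2)))
    with hc'
  have e : (fun j => ∑ i, (c * m.ricUp i j + c' * (m.h i j * m.scal)) * D.d i f)
      = c • (m.ricUpM *ᵥ D.dv f) + c' • (m.scal • (m.h *ᵥ D.dv f)) := by
    ext j
    simp only [Pi.add_apply, Pi.smul_apply, smul_eq_mul, mulVec, dotProduct, mul_sum,
      ← sum_add_distrib]
    refine sum_congr rfl fun i _ => ?_
    rw [m.ricUp_eq, m.h_comm i j, show m.ricUpM i j = m.ricUpM j i from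
      congrFun (congrFun m.ricUpM_symm j) i, dv]
    ring
  rw [e, div_add, m.div_const_smul (dv_algebraMap D _), m.div_const_smul (dv_algebraMap D _),
    div_smul, grad_dot, ← lap_eq_div, ricSq_eq, m.gam_comm f]
  linear_combination c * m.div_ricUp f

end Metric
end CoordAlgebra
end Paneitz
end

/-! ### Conformal change of the metric. -/

noncomputable section

namespace Paneitz

open Matrix Finset

namespace CoordAlgebra

variable {n : ℕ} {A : Type*} [CommRing A] [Algebra ℝ A] {D : CoordAlgebra n A}

namespace Metric

/-- The metric `m'` is `w = exp (2 s)` times the metric `m`, and `v` is the inverse of `w`. -/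
structure IsConformal (m' m : D.Metric) (s w v : A) : Prop where
  g_eq : m'.g = w • m.g
  h_eq : m'.h = v • m.h
  mul_eq : v * w = 1
  dv_w : D.dv w = (2 * w) • D.dv s

variable {m' m : D.Metric} {s w v : A}

namespace IsConformal

theorem dv_v (hc : IsConformal m' m s w v) : D.dv v = (-2 * v) • D.dv s := by
  have e := congrArg D.dv hc.mul_eq
  have e1 : D.dv (1 : A) = 0 := by ext i; simp [dv]
  rw [dv_mul, e1, hc.dv_w] at e
  ext i
  have e2 := congrFun e i
  simp only [Pi.add_apply, Pi.smul_apply, smul_eq_mul, Pi.zero_apply] at e2 ⊢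
  linear_combination v * e2 - (D.dv v i + 2 * v * D.dv s i) * hc.mul_eq

/-- Each derivative of `w • g` contributes an extra `2 w ∂s` times `g`, and the `w` cancels the `v`
of the inverse metric. The entries of the identity matrix are Kronecker deltas. -/
theorem chr_eq (hc : IsConformal m' m s w v) (k i j : Fin n) :
    m'.chr k i j = m.chr k i j + (1 : Matrix (Fin n) (Fin n) A) k j * D.dv s i
      + (1 : Matrix (Fin n) (Fin n) A) k i * D.dv s j - m.g i j * (m.h *ᵥ D.dv s) k := by
  have e : ∀ j, ∑ l, m.h k l * m.g j l = (1 : Matrix (Fin n) (Fin n) A) k j := by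
    intro j
    rw [← m.h_mul_g, Matrix.mul_apply]
    exact sum_congr rfl fun l _ => by rw [m.g_comm j l]
  have e1 : ∑ l, m'.h k l * (D.d i (m'.g j l) + D.d j (m'.g i l) - D.d l (m'.g i j))
      = ∑ l, m.h k l * (D.d i (m.g j l) + D.d j (m.g i l) - D.d l (m.g i j))
        + (2 : ℝ) • ((1 : Matrix (Fin n) (Fin n) A) k j * D.dv s i
          + (1 : Matrix (Fin n) (Fin n) A) k i * D.dv s j - m.g i j * (m.h *ᵥ D.dv s) k) := by
    rw [← e, ← e, mulVec, dotProduct, sum_mul, sum_mul, mul_sum, ← sum_add_distrib,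
      ← sum_sub_distrib, smul_sum, ← sum_add_distrib]
    refine sum_congr rfl fun l _ => ?_
    have h1 : ∀ i, D.d i w = 2 * w * D.dv s i := fun i => congrFun hc.dv_w i
    rw [two_smul]
    simp only [hc.g_eq, hc.h_eq, Matrix.smul_apply, smul_eq_mul, Derivation.leibniz, h1]
    linear_combination (m.h k l * (D.d i (m.g j l) + D.d j (m.g i l) - D.d l (m.g i j))
      + 2 * (m.h k l * m.g j l * D.dv s i + m.h k l * m.g i l * D.dv s j
        - m.g i j * (m.h k l * D.dv s l))) * hc.mul_eq
  rw [chr, e1, smul_add, smul_smul, chr]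
  norm_num
  ring

theorem hess_eq (hc : IsConformal m' m s w v) (f : A) :
    m'.hess f = m.hess f - vecMulVec (D.dv s) (D.dv f) - vecMulVec (D.dv f) (D.dv s)
      + m.gam s f • m.g := by
  ext i j
  have e : ∑ k, (m.h *ᵥ D.dv s) k * D.dv f k = m.gam s f := m.grad_dot s f
  have e1 : ∑ k, m'.chr k i j * D.dv f k = ∑ k, m.chr k i j * D.dv f k
      + D.dv s i * D.dv f j + D.dv f i * D.dv s j - m.gam s f * m.g i j := by
    rw [← e]
    simp only [hc.chr_eq, add_mul, sub_mul, sum_add_distrib, sum_sub_distrib, Matrix.one_apply,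
      ite_mul, one_mul, zero_mul, sum_ite_eq', mem_univ, if_true, sum_mul]
    congr 1
    · ring
    · exact sum_congr rfl fun k _ => by ring
  simp only [hess, conn, of_apply, Matrix.add_apply, Matrix.sub_apply, Matrix.smul_apply,
    vecMulVec_apply, Pi.sub_apply, smul_eq_mul, mulVec, dotProduct, transpose_apply, e1]
  ring

theorem hessUp_eq (hc : IsConformal m' m s w v) (f : A) :
    m'.hessUp f = v ^ 2 • (m.hessUp f - m.outer s f - m.outer f s + m.gam s f • m.h) := by
  have e : m.h * m.g * m.h = m.h := by rw [m.h_mul_g, one_mul]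
  rw [hessUp, hc.hess_eq, hc.h_eq, hessUp, outer, outer]
  simp only [mul_add, add_mul, mul_sub, sub_mul, Matrix.mul_smul, Matrix.smul_mul, smul_smul, e,
    smul_add, smul_sub, sq]
  rw [mul_comm (m.gam s f) v, mul_assoc v v]

theorem gam_eq (hc : IsConformal m' m s w v) (a b : A) : m'.gam a b = v * m.gam a b := by
  rw [gam, hc.h_eq, pair_smul, gam]

theorem ctr_eq (hc : IsConformal m' m s w v) (S T : Matrix (Fin n) (Fin n) A) :
    m'.ctr S T = w ^ 2 * m.ctr S T := by
  simp only [ctr, hc.g_eq, Matrix.mul_smul, Matrix.smul_mul, trace_smul, smul_eq_mul]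
  ring

theorem trace_eq (hc : IsConformal m' m s w v) (T : Matrix (Fin n) (Fin n) A) :
    (m'.g * T).trace = w * (m.g * T).trace := by
  simp only [hc.g_eq, Matrix.smul_mul, trace_smul, smul_eq_mul]

theorem lap_eq (hc : IsConformal m' m s w v) (f : A) :
    m'.lap f = v * (m.lap f + ((n : A) - 2) * m.gam s f) := by
  rw [Metric.lap_eq, hc.trace_eq, hc.hessUp_eq, m.lap_eq f]
  simp only [Matrix.mul_smul, mul_add, mul_sub, trace_smul, trace_add, trace_sub, smul_eq_mul,
    trace_g_mul_h, trace_g_mul_outer, m.gam_comm f s]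
  linear_combination v * ((m.g * m.hessUp f).trace + ((n : A) - 2) * m.gam s f) * hc.mul_eq

theorem dv_natCast_sub (D : CoordAlgebra n A) (k l : ℕ) : D.dv ((k : A) - (l : A)) = 0 := by
  rw [dv_sub, dv_natCast, dv_natCast, sub_zero]

/-- The Laplacian of `m'` on the functions of weight `-2`. -/
theorem lap_v_mul (hc : IsConformal m' m s w v) (a : A) :
    m'.lap (v * a) = v ^ 2 * (m.lap a + ((n : A) - 6) * m.gam s a
      - (2 * m.lap s + 2 * ((n : A) - 4) * m.gam s s) * a) := by
  have h2 : D.dv (-2 : A) = 0 := by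
    simpa using dv_natCast_sub D 0 2
  rw [hc.lap_eq, lap_mul, m.lap_of_dv hc.dv_v, m.gam_const_mul_right h2, m.gam_of_dv hc.dv_v,
    gam_mul_right, m.gam_of_dv_right hc.dv_v]
  ring

theorem lap_lap (hc : IsConformal m' m s w v) (f : A) :
    m'.lap (m'.lap f) = v ^ 2 * (m.lap (m.lap f + ((n : A) - 2) * m.gam s f)
      + ((n : A) - 6) * m.gam s (m.lap f + ((n : A) - 2) * m.gam s f)
      - (2 * m.lap s + 2 * ((n : A) - 4) * m.gam s s) * (m.lap f + ((n : A) - 2) * m.gam s f)) := by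
  rw [hc.lap_eq f, hc.lap_v_mul]

theorem dv_sub_two (D : CoordAlgebra n A) : D.dv ((n : A) - 2) = 0 := by
  simpa using dv_natCast_sub D n 2

/-- The quadratic term needed to write the Bochner formula of `m'` in terms of `m`. -/
theorem ctr_hessUp (hc : IsConformal m' m s w v) (a b : A) :
    m'.ctr (m'.hessUp a) (m'.hessUp b) = v ^ 2 * (m.ctr (m.hessUp a) (m.hessUp b)
      - 2 * D.pair (m.hessUp a) s b - 2 * D.pair (m.hessUp b) s a + m.lap a * m.gam s b
      + m.lap b * m.gam s a + 2 * m.gam s s * m.gam a b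
      + ((n : A) - 2) * m.gam s a * m.gam s b) := by
  rw [hc.ctr_eq, hc.hessUp_eq, hc.hessUp_eq]
  simp only [ctr_smul_left, ctr_smul_right, ctr_add_left, ctr_add_right, ctr_sub_left,
    ctr_sub_right, ctr_outer_left, ctr_outer_right, ctr_h_left, ctr_h_right, trace_g_mul_h,
    trace_g_mul_outer, ← m.lap_eq, pair_outer, pair_smul, pair_add, pair_sub, Matrix.mul_smul,
    mul_add, mul_sub, trace_smul, trace_add, trace_sub, smul_eq_mul, gam]
  simp only [← gam.eq_def]
  rw [D.pair_comm (m.hessUp_symm a) b s, D.pair_comm (m.hessUp_symm b) a s, m.gam_comm a s,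
    m.gam_comm b s]
  -- The factor `v * w + 1` turns `v * w = 1` into `v ^ 2 * w ^ 2 = 1`.
  linear_combination v ^ 2 * (m.ctr (m.hessUp a) (m.hessUp b)
      - 2 * D.pair (m.hessUp a) s b - 2 * D.pair (m.hessUp b) s a + m.lap a * m.gam s b
      + m.lap b * m.gam s a + 2 * m.gam s s * m.gam a b
      + ((n : A) - 2) * m.gam s a * m.gam s b) * (v * w + 1) * hc.mul_eq

/-- In the Bochner formula of `m'` every term except Ricci has a known law. Subtracting the Bochner
formula of `m` isolates the Ricci tensor, tested on arbitrary `a` and `b`. -/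
theorem ricUpM_eq (hc : IsConformal m' m s w v) :
    m'.ricUpM = v ^ 2 • (m.ricUpM + ((n : A) - 2) • (m.hessUp s - m.outer s s)
      + (m.lap s + ((n : A) - 2) * m.gam s s) • m.h) := by
  refine D.ext_of_pair fun a b => two_mul_cancel ?_
  have hb := m'.bochner a b
  have hb0 := m.bochner a b
  rw [hc.ctr_hessUp, hc.gam_eq a b, hc.lap_v_mul, hc.gam_eq, hc.gam_eq, hc.lap_eq, hc.lap_eq,
    gam_mul_right, gam_mul_right, gam_add_right, gam_add_right,
    m.gam_const_mul_right (dv_sub_two D), m.gam_const_mul_right (dv_sub_two D),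
    m.gam_of_dv_right hc.dv_v, m.gam_of_dv_right hc.dv_v, gam_gam, gam_gam, gam_gam] at hb
  simp only [pair_smul, pair_add, pair_sub, pair_outer]
  rw [D.pair_comm (m.hessUp_symm _) b a, D.pair_comm (m.hessUp_symm _) b s,
    D.pair_comm (m.hessUp_symm _) a s, m.gam_comm a s, m.gam_comm b s] at hb
  simp only [← gam.eq_def]
  linear_combination hb - v ^ 2 * hb0

theorem scal_eq (hc : IsConformal m' m s w v) :
    m'.scal = v * (m.scal + (2 * ((n : A) - 1)) * m.lap s
      + (((n : A) - 1) * ((n : A) - 2)) * m.gam s s) := by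
  rw [Metric.scal_eq, hc.trace_eq, hc.ricUpM_eq, m.scal_eq, m.lap_eq]
  simp only [Matrix.mul_smul, mul_add, mul_sub, trace_smul, trace_add, trace_sub, smul_eq_mul,
    trace_g_mul_h, trace_g_mul_outer]
  linear_combination v * ((m.g * m.ricUpM).trace + (2 * ((n : A) - 1)) * (m.g * m.hessUp s).trace
      + (((n : A) - 1) * ((n : A) - 2)) * m.gam s s) * hc.mul_eq

theorem ctr_ricUpM_hessUp (hc : IsConformal m' m s w v) (f : A) :
    m'.ctr m'.ricUpM (m'.hessUp f) = v ^ 2 * (m.ctr m.ricUpM (m.hessUp f)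
      - 2 * D.pair m.ricUpM s f + m.gam s f * m.scal
      + ((n : A) - 2) * (m.ctr (m.hessUp s) (m.hessUp f) - 2 * D.pair (m.hessUp s) s f
        + m.gam s f * m.lap s - D.pair (m.hessUp f) s s + m.gam s s * m.gam s f)
      + (m.lap s + ((n : A) - 2) * m.gam s s) * (m.lap f + ((n : A) - 2) * m.gam s f)) := by
  rw [hc.ctr_eq, hc.ricUpM_eq, hc.hessUp_eq]
  simp only [ctr_smul_left, ctr_smul_right, ctr_add_left, ctr_add_right, ctr_sub_left,
    ctr_sub_right, ctr_outer_left, ctr_outer_right, ctr_h_left, ctr_h_right, trace_g_mul_h,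
    trace_g_mul_outer, pair_outer, pair_smul, pair_add, pair_sub, Matrix.mul_smul,
    mul_add, mul_sub, trace_smul, trace_add, trace_sub, smul_eq_mul, gam]
  simp only [← gam.eq_def, ← m.lap_eq, ← m.scal_eq]
  rw [D.pair_comm m.ricUpM_symm f s, D.pair_comm (m.hessUp_symm s) f s, m.gam_comm f s]
  linear_combination v ^ 2 * (m.ctr m.ricUpM (m.hessUp f)
      - 2 * D.pair m.ricUpM s f + m.gam s f * m.scal
      + ((n : A) - 2) * (m.ctr (m.hessUp s) (m.hessUp f) - 2 * D.pair (m.hessUp s) s f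
        + m.gam s f * m.lap s - D.pair (m.hessUp f) s s + m.gam s s * m.gam s f)
      + (m.lap s + ((n : A) - 2) * m.gam s s) * (m.lap f + ((n : A) - 2) * m.gam s f))
      * (v * w + 1) * hc.mul_eq

theorem ctr_ricUpM_self (hc : IsConformal m' m s w v) :
    m'.ctr m'.ricUpM m'.ricUpM = v ^ 2 * (m.ctr m.ricUpM m.ricUpM
      + 2 * ((n : A) - 2) * (m.ctr m.ricUpM (m.hessUp s) - D.pair m.ricUpM s s)
      + 2 * (m.lap s + ((n : A) - 2) * m.gam s s) * m.scal
      + ((n : A) - 2) ^ 2 * (m.ctr (m.hessUp s) (m.hessUp s) - 2 * D.pair (m.hessUp s) s s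
        + m.gam s s ^ 2)
      + 2 * ((n : A) - 2) * (m.lap s + ((n : A) - 2) * m.gam s s) * (m.lap s - m.gam s s)
      + n * (m.lap s + ((n : A) - 2) * m.gam s s) ^ 2) := by
  rw [hc.ctr_eq, hc.ricUpM_eq]
  simp only [ctr_smul_left, ctr_smul_right, ctr_add_left, ctr_add_right, ctr_sub_left,
    ctr_sub_right, ctr_outer_left, ctr_outer_right, ctr_h_left, ctr_h_right, trace_g_mul_h,
    trace_g_mul_outer, pair_outer, m.ctr_comm (m.hessUp s) m.ricUpM, pair_smul, pair_add, pair_sub, Matrix.mul_smul,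
    mul_add, mul_sub, trace_smul, trace_add, trace_sub, smul_eq_mul, gam]
  simp only [← gam.eq_def, ← m.lap_eq, ← m.scal_eq]
  linear_combination v ^ 2 * (m.ctr m.ricUpM m.ricUpM
      + 2 * ((n : A) - 2) * (m.ctr m.ricUpM (m.hessUp s) - D.pair m.ricUpM s s)
      + 2 * (m.lap s + ((n : A) - 2) * m.gam s s) * m.scal
      + ((n : A) - 2) ^ 2 * (m.ctr (m.hessUp s) (m.hessUp s) - 2 * D.pair (m.hessUp s) s s
        + m.gam s s ^ 2)
      + 2 * ((n : A) - 2) * (m.lap s + ((n : A) - 2) * m.gam s s) * (m.lap s - m.gam s s)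
      + n * (m.lap s + ((n : A) - 2) * m.gam s s) ^ 2) * (v * w + 1) * hc.mul_eq

/-- The conformal covariance of the quartic operator. -/
theorem quartic_eq (hc : IsConformal m' m s w v) (hn : 2 < n) {u : A}
    (hu : D.dv u = (algebraMap ℝ A (((n : ℝ) - 4) / 2) * u) • D.dv s) (f : A)
    (ev : A →ₐ[ℝ] ℝ) :
    ev (u * w ^ 2 * m'.quartic f) = ev (m.quartic (u * f)) := by
  have hcst : D.dv (algebraMap ℝ A (((n : ℝ) - 4) / 2)) = 0 := dv_algebraMap D _
  have k1 : D.dv (2 * ((n : A) - 1)) = 0 := by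
    simpa [mul_sub] using dv_natCast_sub D (2 * n) 2
  have k2 : D.dv (((n : A) - 1) * ((n : A) - 2)) = 0 := by
    have e1 : D.dv ((n : A) - 1) = 0 := by simpa using dv_natCast_sub D n 1
    rw [dv_mul, dv_sub_two, e1, smul_zero, smul_zero, add_zero]
  have k3 : D.dv (2 * algebraMap ℝ A (((n : ℝ) - 4) / 2)) = 0 := by
    rw [two_mul, dv_add, hcst, add_zero]
  have k4 : D.dv (algebraMap ℝ A (((n : ℝ) - 4) / 2) ^ 2) = 0 := by
    rw [sq, dv_mul, hcst, smul_zero, add_zero]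
  have q1 := m'.two_mul_quartic f
  have q2 := m.two_mul_quartic (u * f)
  have lu : ∀ a, m.lap (u * a) = u * (m.lap a
      + (2 * algebraMap ℝ A (((n : ℝ) - 4) / 2)) * m.gam s a
      + (algebraMap ℝ A (((n : ℝ) - 4) / 2) * m.lap s
        + algebraMap ℝ A (((n : ℝ) - 4) / 2) ^ 2 * m.gam s s) * a) := by
    intro a
    rw [lap_mul, m.lap_of_dv hu, m.gam_of_dv hu, m.gam_const_mul_right hcst,
      m.gam_of_dv_right hu]
    ring
  rw [hc.lap_lap, hc.scal_eq, hc.lap_v_mul, hc.lap_eq, hc.gam_eq, gam_mul_left, m.gam_of_dv hc.dv_v,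
    hc.ctr_ricUpM_self, hc.ctr_ricUpM_hessUp] at q1
  simp only [gam_add_left, gam_add_right, lap_add, m.gam_const_mul_left k1,
    m.gam_const_mul_right k1, m.lap_const_mul k1, m.gam_const_mul_left k2,
    m.gam_const_mul_right k2, m.lap_const_mul k2, m.gam_const_mul_right (dv_sub_two D),
    m.lap_const_mul (dv_sub_two D)] at q1
  rw [lu f, lu, gam_mul_right, m.gam_of_dv_right hu, hessUp_mul, m.hessUp_of_dv hu hcst] at q2
  have o1 : m.outer u f = (algebraMap ℝ A (((n : ℝ) - 4) / 2) * u) • m.outer s f := by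
    simp only [outer, hu, smul_vecMulVec, Matrix.mul_smul, Matrix.smul_mul]
  have o2 : m.outer f u = (algebraMap ℝ A (((n : ℝ) - 4) / 2) * u) • m.outer f s := by
    simp only [outer, hu, vecMulVec_smul, Matrix.mul_smul, Matrix.smul_mul]
  simp only [o1, o2, gam_add_left, gam_add_right, lap_add, m.gam_const_mul_right k3,
    m.lap_const_mul k3, lap_mul _ _ f, gam_mul_right _ _ f, m.gam_const_mul_left hcst,
    m.gam_const_mul_right hcst, m.lap_const_mul hcst, m.gam_const_mul_left k4,
    m.gam_const_mul_right k4, m.lap_const_mul k4, ctr_add_right, ctr_smul_right,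
    ctr_outer_right] at q2
  rw [D.pair_comm m.ricUpM_symm f s] at q2
  -- These five identities remove the Laplacians of `gam s f` and `gam s s` and their iterated
  -- gradients, after which the remaining scalars can be treated as independent.
  have b1 := m.bochner s f
  have b2 := m.bochner s s
  have g1 := m.gam_gam s s f
  have g2 := m.gam_gam f s s
  have g3 := m.gam_gam s s s
  rw [D.pair_comm (m.hessUp_symm s) f s, m.gam_comm f] at g2
  rw [m.gam_comm f] at b1
  -- The coefficients have denominators `n - 1` and `n - 2`; evaluating in `ℝ` makes them, and the
  -- value of `v`, invertible elements of a field.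
  replace q1 := congrArg ev q1
  replace q2 := congrArg ev q2
  replace b1 := congrArg ev b1
  replace b2 := congrArg ev b2
  replace g1 := congrArg ev g1
  replace g2 := congrArg ev g2
  replace g3 := congrArg ev g3
  have hvw := congrArg ev hc.mul_eq
  have e2 : ∀ r : ℝ, ev (algebraMap ℝ A r) = r := fun r => by rw [AlgHom.commutes]; rfl
  rw [m.gam_comm m.scal s] at q2
  simp only [map_mul, map_add, map_sub, map_neg, map_pow, e2, map_natCast, map_ofNat, map_one]
    at q1 q2 b1 b2 g1 g2 g3 hvw ⊢
  rw [b1, b2, g1, g2, g3] at q1 q2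
  have n2 : (n : ℝ) - 2 ≠ 0 := sub_ne_zero.mpr (by exact_mod_cast hn.ne')
  have n1 : (n : ℝ) - 1 ≠ 0 := sub_ne_zero.mpr (by exact_mod_cast (by omega : n ≠ 1))
  have v0 : ev v ≠ 0 := left_ne_zero_of_mul_eq_one hvw
  have hw : ev w = (ev v)⁻¹ := eq_inv_of_mul_eq_one_right hvw
  have q1' := eq_div_of_mul_eq two_ne_zero ((mul_comm _ _).trans q1)
  have q2' := eq_div_of_mul_eq two_ne_zero ((mul_comm _ _).trans q2)
  rw [q1', q2', hw]
  clear q1 q2 q1' q2' b1 b2 g1 g2 g3 hvw hw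
  generalize ev v = v' at *
  generalize (n : ℝ) = N at *
  field_simp
  ring

end IsConformal
end Metric
end CoordAlgebra
end Paneitz
end

/-! ### Change of coordinates. -/

noncomputable section

namespace Paneitz

open Matrix Finset

namespace CoordAlgebra

namespace Metric

variable {n : ℕ} {A B : Type*} [CommRing A] [Algebra ℝ A] [CommRing B] [Algebra ℝ B]
  {D : CoordAlgebra n A} {E : CoordAlgebra n B}

/-- The metric `m` is the pullback of the metric `m'` under the change of variables `ψ`, whose
Jacobian matrix is `J`. -/
structure IsPullback (m : D.Metric) (m' : E.Metric) (ψ : B →ₐ[ℝ] A)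
    (J K : Matrix (Fin n) (Fin n) A) : Prop where
  d_eq : ∀ i b, D.d i (ψ b) = ∑ k, J k i * ψ (E.d k b)
  mul_eq : J * K = 1
  g_eq : m.g = Jᵀ * m'.g.map ψ * J

variable {m : D.Metric} {m' : E.Metric} {ψ : B →ₐ[ℝ] A} {J K : Matrix (Fin n) (Fin n) A}

namespace IsPullback

theorem dv_eq (hp : IsPullback m m' ψ J K) (b : B) : D.dv (ψ b) = Jᵀ *ᵥ (ψ ∘ E.dv b) := by
  ext i
  exact hp.d_eq i b

theorem h_eq (hp : IsPullback m m' ψ J K) : J * m.h * Jᵀ = m'.h.map ψ := by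
  have e1 : K * J = 1 := mul_eq_one_comm.mp hp.mul_eq
  have e2 : m'.g.map ψ * m'.h.map ψ = 1 := by
    rw [← Matrix.map_mul, m'.g_mul_h, Matrix.map_one _ (map_zero ψ) (map_one ψ)]
  have e3 : m.g * (K * m'.h.map ψ * Kᵀ) = 1 := by
    calc m.g * (K * m'.h.map ψ * Kᵀ)
        = Jᵀ * (m'.g.map ψ * (J * K) * m'.h.map ψ) * Kᵀ := by
          rw [hp.g_eq]; simp only [mul_assoc]
      _ = 1 := by
          rw [hp.mul_eq, mul_one, e2, mul_one, ← transpose_mul, e1, transpose_one]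
  have e4 : m.h = K * m'.h.map ψ * Kᵀ := by
    calc m.h = m.h * (m.g * (K * m'.h.map ψ * Kᵀ)) := by rw [e3, mul_one]
      _ = _ := by rw [← mul_assoc, m.h_mul_g, one_mul]
  calc J * m.h * Jᵀ = (J * K) * m'.h.map ψ * (J * K)ᵀ := by
        rw [e4, transpose_mul]; simp only [mul_assoc]
    _ = _ := by rw [hp.mul_eq, transpose_one, one_mul, mul_one]

theorem pair_eq (hp : IsPullback m m' ψ J K) {T : Matrix (Fin n) (Fin n) A}
    {T' : Matrix (Fin n) (Fin n) B} (hT : J * T * Jᵀ = T'.map ψ) (a b : B) :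
    D.pair T (ψ a) (ψ b) = ψ (E.pair T' a b) := by
  have e : ψ (E.pair T' a b) = (ψ ∘ E.dv a) ⬝ᵥ (T'.map ψ *ᵥ (ψ ∘ E.dv b)) := by
    simp only [pair, dotProduct, mulVec, map_sum, map_mul, Function.comp, map_apply]
  rw [e, ← hT, pair, hp.dv_eq, hp.dv_eq, mulVec_transpose J, ← dotProduct_mulVec,
    mulVec_mulVec, mulVec_mulVec, mul_assoc]

/-- The converse of `pair_eq`: testing on the coordinates of the target recovers each component. -/
theorem of_pair (hp : IsPullback m m' ψ J K) {T : Matrix (Fin n) (Fin n) A}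
    {T' : Matrix (Fin n) (Fin n) B}
    (h : ∀ a b, D.pair T (ψ a) (ψ b) = ψ (E.pair T' a b)) : J * T * Jᵀ = T'.map ψ := by
  ext i j
  have e : ∀ j, (ψ ∘ E.dv (E.x j)) = Pi.single j 1 := by
    intro j; ext i; by_cases hij : i = j <;> simp [dv, E.d_x, hij]
  have h1 := h (E.x i) (E.x j)
  rw [E.pair_x] at h1
  rw [map_apply, ← h1, pair, hp.dv_eq, hp.dv_eq, mulVec_transpose J, ← dotProduct_mulVec,
    mulVec_mulVec, mulVec_mulVec, e, e]
  simp

theorem gam_eq (hp : IsPullback m m' ψ J K) (a b : B) : m.gam (ψ a) (ψ b) = ψ (m'.gam a b) :=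
  hp.pair_eq hp.h_eq a b

/-- The Koszul formula expresses the Hessian by `gam` alone, so no transformation of Christoffel
symbols is needed. -/
theorem hessUp_eq (hp : IsPullback m m' ψ J K) (f : B) :
    J * m.hessUp (ψ f) * Jᵀ = (m'.hessUp f).map ψ := by
  refine hp.of_pair fun a b => two_mul_cancel ?_
  rw [koszul, hp.gam_eq, hp.gam_eq, hp.gam_eq, hp.gam_eq, hp.gam_eq, hp.gam_eq, ← map_add,
    ← map_sub, ← m'.koszul, map_mul, map_ofNat]

theorem map_trace (ψ : B →ₐ[ℝ] A) (M : Matrix (Fin n) (Fin n) B) :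
    ψ M.trace = (M.map ψ).trace := by
  simp [trace, map_sum]

theorem trace_eq (hp : IsPullback m m' ψ J K) {T : Matrix (Fin n) (Fin n) A}
    {T' : Matrix (Fin n) (Fin n) B} (hT : J * T * Jᵀ = T'.map ψ) :
    (m.g * T).trace = ψ (m'.g * T').trace := by
  rw [map_trace, Matrix.map_mul, ← hT, hp.g_eq, mul_assoc, mul_assoc, trace_mul_comm]
  simp only [mul_assoc]

theorem ctr_eq (hp : IsPullback m m' ψ J K) {S T : Matrix (Fin n) (Fin n) A}
    {S' T' : Matrix (Fin n) (Fin n) B} (hS : J * S * Jᵀ = S'.map ψ) (hT : J * T * Jᵀ = T'.map ψ) :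
    m.ctr S T = ψ (m'.ctr S' T') := by
  rw [ctr, ctr, map_trace, Matrix.map_mul, Matrix.map_mul, Matrix.map_mul, ← hS, ← hT, hp.g_eq]
  have : Jᵀ * m'.g.map ψ * J * S * (Jᵀ * m'.g.map ψ * J) * T
      = Jᵀ * (m'.g.map ψ * J * S * Jᵀ * m'.g.map ψ * J * T) := by simp only [mul_assoc]
  rw [this, trace_mul_comm]
  simp only [mul_assoc]

theorem lap_eq (hp : IsPullback m m' ψ J K) (f : B) : m.lap (ψ f) = ψ (m'.lap f) := by
  rw [Metric.lap_eq, Metric.lap_eq, hp.trace_eq (hp.hessUp_eq f)]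

/-- All other terms of the Bochner formula are already known to be natural, hence so is the Ricci
term. -/
theorem ricUpM_eq (hp : IsPullback m m' ψ J K) : J * m.ricUpM * Jᵀ = m'.ricUpM.map ψ := by
  refine hp.of_pair fun a b => two_mul_cancel ?_
  have e1 := m.bochner (ψ a) (ψ b)
  have e2 := congrArg ψ (m'.bochner a b)
  rw [hp.ctr_eq (hp.hessUp_eq a) (hp.hessUp_eq b), hp.gam_eq, hp.lap_eq, hp.lap_eq, hp.lap_eq,
    hp.gam_eq, hp.gam_eq] at e1
  simp only [map_add, map_sub, map_mul, map_ofNat] at e2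
  linear_combination e1 - e2

theorem scal_eq (hp : IsPullback m m' ψ J K) : m.scal = ψ m'.scal := by
  rw [Metric.scal_eq, Metric.scal_eq, hp.trace_eq hp.ricUpM_eq]

/-- The invariance of the quartic operator under changes of coordinates. -/
theorem quartic_eq (hp : IsPullback m m' ψ J K) (f : B) :
    m.quartic (ψ f) = ψ (m'.quartic f) := by
  refine two_mul_cancel ?_
  have e : 2 * ψ (m'.quartic f) = ψ (2 * m'.quartic f) := by rw [map_mul, map_ofNat]
  rw [e, two_mul_quartic, two_mul_quartic, hp.scal_eq, hp.lap_eq, hp.lap_eq, hp.lap_eq, hp.gam_eq,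
    hp.ctr_eq hp.ricUpM_eq (hp.hessUp_eq f), hp.ctr_eq hp.ricUpM_eq hp.ricUpM_eq]
  simp only [map_add, map_sub, map_mul, map_pow, map_ofNat, AlgHom.commutes]

end IsPullback
end Metric
end CoordAlgebra
end Paneitz
end

/-! ### Germs of smooth functions. -/

noncomputable section

namespace Paneitz

open Filter Topology

variable {n : ℕ}

/-- The algebra of the functions that are smooth at `y`. -/
def smoothAt (y : Model n) : Subalgebra ℝ (Model n → ℝ) where
  carrier := {f | ContDiffAt ℝ ∞ f y}
  mul_mem' {f g} hf hg := by
    have hf' : ContDiffAt ℝ ∞ f y := hf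
    have hg' : ContDiffAt ℝ ∞ g y := hg
    exact hf'.mul hg'
  add_mem' {f g} hf hg := by
    have hf' : ContDiffAt ℝ ∞ f y := hf
    have hg' : ContDiffAt ℝ ∞ g y := hg
    exact hf'.add hg'
  algebraMap_mem' c := by
    change ContDiffAt ℝ ∞ (fun _ : Model n => c) y
    exact contDiffAt_const

theorem mem_smoothAt {y : Model n} {f : Model n → ℝ} : f ∈ smoothAt y ↔ ContDiffAt ℝ ∞ f y :=
  Iff.rfl

/-- The ideal of the functions that vanish near `y`. -/
def nullIdeal (y : Model n) : Ideal (smoothAt y) where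
  carrier := {f | (f : Model n → ℝ) =ᶠ[𝓝 y] 0}
  add_mem' {f g} hf hg := by
    filter_upwards [hf, hg] with z h1 h2
    simp [h1, h2]
  zero_mem' := EventuallyEq.refl _ _
  smul_mem' c f hf := by
    filter_upwards [hf] with z h1
    simp [h1]

/-- The algebra of the germs at `y` of smooth functions. -/
abbrev SmoothGerm (y : Model n) := smoothAt y ⧸ nullIdeal y

/-- The function `f` represents the germ `a`. -/
def IsGerm {y : Model n} (f : Model n → ℝ) (a : SmoothGerm y) : Prop :=
  ∃ hf : ContDiffAt ℝ ∞ f y, Ideal.Quotient.mk (nullIdeal y) ⟨f, hf⟩ = a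

theorem exists_germ {y : Model n} {f : Model n → ℝ} (hf : ContDiffAt ℝ ∞ f y) :
    ∃ a : SmoothGerm y, IsGerm f a := ⟨_, hf, rfl⟩

theorem exists_isGerm {y : Model n} (a : SmoothGerm y) : ∃ f, IsGerm f a := by
  obtain ⟨⟨f, hf⟩, h⟩ := Ideal.Quotient.mk_surjective a
  exact ⟨f, hf, h⟩

namespace IsGerm

variable {y : Model n} {f f' : Model n → ℝ} {a b : SmoothGerm y}

theorem eq_iff (ha : IsGerm f a) (hb : IsGerm f' b) : a = b ↔ f =ᶠ[𝓝 y] f' := by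
  obtain ⟨hf, rfl⟩ := ha
  obtain ⟨hf', rfl⟩ := hb
  rw [Ideal.Quotient.eq]
  constructor
  · intro h
    have h' : (f - f') =ᶠ[𝓝 y] 0 := h
    filter_upwards [h'] with z hz
    exact sub_eq_zero.mp hz
  · intro h
    change (f - f') =ᶠ[𝓝 y] 0
    filter_upwards [h] with z hz
    exact sub_eq_zero.mpr hz

theorem congr (ha : IsGerm f a) (h : f' =ᶠ[𝓝 y] f) : IsGerm f' a := by
  have hf' : ContDiffAt ℝ ∞ f' y := ha.1.congr_of_eventuallyEq h
  obtain ⟨b, hb⟩ := exists_germ hf'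
  rwa [← (hb.eq_iff ha).mpr h]

theorem add (ha : IsGerm f a) (hb : IsGerm f' b) : IsGerm (fun z => f z + f' z) (a + b) := by
  obtain ⟨hf, rfl⟩ := ha
  obtain ⟨hf', rfl⟩ := hb
  exact ⟨hf.add hf', rfl⟩

theorem mul (ha : IsGerm f a) (hb : IsGerm f' b) : IsGerm (fun z => f z * f' z) (a * b) := by
  obtain ⟨hf, rfl⟩ := ha
  obtain ⟨hf', rfl⟩ := hb
  exact ⟨hf.mul hf', rfl⟩

theorem sub (ha : IsGerm f a) (hb : IsGerm f' b) : IsGerm (fun z => f z - f' z) (a - b) := by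
  obtain ⟨hf, rfl⟩ := ha
  obtain ⟨hf', rfl⟩ := hb
  exact ⟨hf.sub hf', rfl⟩

theorem const (y : Model n) (c : ℝ) : IsGerm (fun _ => c) (algebraMap ℝ (SmoothGerm y) c) :=
  ⟨contDiffAt_const, rfl⟩

theorem one (y : Model n) : IsGerm (fun _ => 1) (1 : SmoothGerm y) := ⟨contDiffAt_const, rfl⟩

theorem zero (y : Model n) : IsGerm (fun _ => 0) (0 : SmoothGerm y) := ⟨contDiffAt_const, rfl⟩

theorem pow (ha : IsGerm f a) (k : ℕ) : IsGerm (fun z => f z ^ k) (a ^ k) := by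
  obtain ⟨hf, rfl⟩ := ha
  exact ⟨hf.pow k, rfl⟩

theorem sum {ι : Type*} {s : Finset ι} {F : ι → Model n → ℝ} {α : ι → SmoothGerm y}
    (h : ∀ i ∈ s, IsGerm (F i) (α i)) : IsGerm (fun z => ∑ i ∈ s, F i z) (∑ i ∈ s, α i) := by
  classical
  induction s using Finset.induction_on with
  | empty => simpa using zero y
  | insert i s hi ih =>
    simp only [Finset.sum_insert hi]
    exact (h i (Finset.mem_insert_self i s)).add
      (ih fun j hj => h j (Finset.mem_insert_of_mem hj))

end IsGerm

theorem contDiffAt_pd {y : Model n} {f : Model n → ℝ} (hf : ContDiffAt ℝ ∞ f y) (i : Fin n) :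
    ContDiffAt ℝ ∞ (pd i f) y :=
  by
  have h1 : ContDiffAt ℝ ∞ (fderiv ℝ f) y := hf.fderiv_right (by simp)
  have h := h1.clm_apply (contDiffAt_const (c := (EuclideanSpace.single i (1 : ℝ) : Model n)))
  exact h

theorem pd_congr {y : Model n} {f f' : Model n → ℝ} (h : f =ᶠ[𝓝 y] f') (i : Fin n) :
    pd i f =ᶠ[𝓝 y] pd i f' := by
  filter_upwards [h.fderiv (𝕜 := ℝ)] with z hz
  rw [pd, hz, pd]

theorem eventually_differentiableAt {y : Model n} {f : Model n → ℝ} (hf : ContDiffAt ℝ ∞ f y) :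
    ∀ᶠ z in 𝓝 y, DifferentiableAt ℝ f z := by
  -- Smoothness at a point gives, for each finite order, a neighbourhood that may depend on the
  -- order; hence the reduction to order one.
  filter_upwards [(hf.of_le (m := 1) (by simp)).eventually (by simp)] with z hz
  exact hz.differentiableAt (by simp)

/-- The partial derivative of a germ. -/
def pdGerm {y : Model n} (i : Fin n) (a : SmoothGerm y) : SmoothGerm y :=
  Ideal.Quotient.mk (nullIdeal y)
    ⟨pd i (exists_isGerm a).choose, contDiffAt_pd (exists_isGerm a).choose_spec.1 i⟩

/-- `pdGerm` differentiates a chosen representative; functions equal near `y` have derivatives equal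
near `y`, so any representative serves. -/
theorem IsGerm.pd {y : Model n} {f : Model n → ℝ} {a : SmoothGerm y} (ha : IsGerm f a)
    (i : Fin n) : IsGerm (Paneitz.pd i f) (pdGerm i a) := by
  have h1 : IsGerm (Paneitz.pd i (exists_isGerm a).choose) (pdGerm i a) := ⟨_, rfl⟩
  exact h1.congr (pd_congr ((ha.eq_iff (exists_isGerm a).choose_spec).mp rfl) i)

theorem pdGerm_mul {y : Model n} (i : Fin n) (a b : SmoothGerm y) :
    pdGerm i (a * b) = a * pdGerm i b + b * pdGerm i a := by
  obtain ⟨f, hf⟩ := exists_isGerm a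
  obtain ⟨f', hf'⟩ := exists_isGerm b
  refine (((hf.mul hf').pd i).eq_iff ((hf.mul (hf'.pd i)).add (hf'.mul (hf.pd i)))).mpr ?_
  filter_upwards [eventually_differentiableAt hf.1, eventually_differentiableAt hf'.1]
    with z h1 h2
  simp [pd, fderiv_fun_mul h1 h2]

theorem pdGerm_add {y : Model n} (i : Fin n) (a b : SmoothGerm y) :
    pdGerm i (a + b) = pdGerm i a + pdGerm i b := by
  obtain ⟨f, hf⟩ := exists_isGerm a
  obtain ⟨f', hf'⟩ := exists_isGerm b
  refine (((hf.add hf').pd i).eq_iff ((hf.pd i).add (hf'.pd i))).mpr ?_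
  filter_upwards [eventually_differentiableAt hf.1, eventually_differentiableAt hf'.1]
    with z h1 h2
  simp [pd, fderiv_fun_add h1 h2]

theorem pdGerm_algebraMap {y : Model n} (i : Fin n) (c : ℝ) :
    pdGerm i (algebraMap ℝ (SmoothGerm y) c) = 0 := by
  refine (((IsGerm.const y c).pd i).eq_iff (IsGerm.zero y)).mpr (.of_forall fun z => ?_)
  simp [pd]

theorem pdGerm_comm {y : Model n} (i j : Fin n) (a : SmoothGerm y) :
    pdGerm i (pdGerm j a) = pdGerm j (pdGerm i a) := by
  obtain ⟨f, hf⟩ := exists_isGerm a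
  refine (((hf.pd j).pd i).eq_iff ((hf.pd i).pd j)).mpr ?_
  filter_upwards [(hf.1.of_le (m := 2) ENat.LEInfty.out).eventually (by simp)] with z hz
  have hd : DifferentiableAt ℝ (fderiv ℝ f) z :=
    (hz.fderiv_right (m := 1) (by norm_num)).differentiableAt (by simp)
  have e : ∀ i j, pd i (pd j f) z
      = fderiv ℝ (fderiv ℝ f) z (EuclideanSpace.single i 1) (EuclideanSpace.single j 1) := by
    intro i j
    unfold pd
    rw [fderiv_clm_apply hd (differentiableAt_const _)]
    simp
  rw [e, e]
  exact (hz.isSymmSndFDerivAt (by simp)) _ _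

theorem contDiffAt_coord {y : Model n} (i : Fin n) : ContDiffAt ℝ ∞ (fun z : Model n => z i) y :=
  (EuclideanSpace.proj i : Model n →L[ℝ] ℝ).contDiff.contDiffAt

/-- The coordinate functions and the partial derivatives on germs. -/
def germCoord (y : Model n) : CoordAlgebra n (SmoothGerm y) where
  d i := Derivation.mk'
    { toFun := pdGerm i
      map_add' := pdGerm_add i
      map_smul' := fun c a => by
        rw [Algebra.smul_def, pdGerm_mul, pdGerm_algebraMap, mul_zero, add_zero, RingHom.id_apply,
          Algebra.smul_def] }
    (pdGerm_mul i)
  d_comm := pdGerm_comm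
  x i := Ideal.Quotient.mk (nullIdeal y)
    ⟨fun z => z i, mem_smoothAt.mpr (contDiffAt_coord i)⟩
  d_x i j := by
    have h : IsGerm (fun z => z j) (Ideal.Quotient.mk (nullIdeal y)
      ⟨fun z => z j, mem_smoothAt.mpr (contDiffAt_coord j)⟩) := ⟨_, rfl⟩
    have e : pd i (fun z : Model n => z j) = fun _ => if i = j then 1 else 0 := by
      ext z
      have : fderiv ℝ (fun z : Model n => z j) z = (EuclideanSpace.proj j : Model n →L[ℝ] ℝ) :=
        (EuclideanSpace.proj j : Model n →L[ℝ] ℝ).fderiv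
      rw [pd, this]
      simp [eq_comm]
    change pdGerm i _ = _
    have h1 := h.pd i
    rw [e] at h1
    split_ifs at h1 ⊢
    · exact (h1.eq_iff (IsGerm.one y)).mpr (EventuallyEq.refl _ _)
    · exact (h1.eq_iff (IsGerm.zero y)).mpr (EventuallyEq.refl _ _)

theorem IsGerm.d {y : Model n} {f : Model n → ℝ} {a : SmoothGerm y} (ha : IsGerm f a)
    (i : Fin n) : IsGerm (Paneitz.pd i f) ((germCoord y).d i a) := ha.pd i

/-- The value of a germ. -/
def germEval (y : Model n) : SmoothGerm y →ₐ[ℝ] ℝ :=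
  Ideal.Quotient.liftₐ (nullIdeal y) ((Pi.evalAlgHom ℝ (fun _ : Model n => ℝ) y).comp
    (smoothAt y).val) fun f hf => by
      have hf' : (f : Model n → ℝ) =ᶠ[𝓝 y] 0 := hf
      exact hf'.eq_of_nhds

theorem IsGerm.eval_eq {y : Model n} {f : Model n → ℝ} {a : SmoothGerm y} (ha : IsGerm f a) :
    germEval y a = f y := by
  obtain ⟨hf, rfl⟩ := ha
  rfl

/-- The composition of germs with a smooth map. -/
def germComp {y : Model n} {ψ : Model n → Model n} (hψ : ContDiffAt ℝ ∞ ψ y) :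
    SmoothGerm (ψ y) →ₐ[ℝ] SmoothGerm y :=
  Ideal.Quotient.liftₐ (nullIdeal (ψ y))
    ((Ideal.Quotient.mkₐ ℝ (nullIdeal y)).comp
      { toFun := fun f => ⟨(f : Model n → ℝ) ∘ ψ, ContDiffAt.comp y (mem_smoothAt.mp f.2) hψ⟩
        map_one' := rfl
        map_mul' := fun _ _ => rfl
        map_zero' := rfl
        map_add' := fun _ _ => rfl
        commutes' := fun _ => rfl }) fun f hf => by
      have hf' : (f : Model n → ℝ) =ᶠ[𝓝 (ψ y)] 0 := hf
      exact Ideal.Quotient.eq_zero_iff_mem.mpr (hψ.continuousAt.eventually hf')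

theorem IsGerm.comp {y : Model n} {ψ : Model n → Model n} (hψ : ContDiffAt ℝ ∞ ψ y)
    {f : Model n → ℝ} {a : SmoothGerm (ψ y)} (ha : IsGerm f a) :
    IsGerm (f ∘ ψ) (germComp hψ a) := by
  obtain ⟨hf, rfl⟩ := ha
  exact ⟨hf.comp y hψ, rfl⟩

end Paneitz
end

/-! ### From germs to functions of the coordinates. -/

noncomputable section

namespace Paneitz

open Filter Topology Matrix

variable {n : ℕ}

/-- `G` is the matrix of a smooth pseudo-Riemannian metric near `y`. -/
structure IsMetricAt (G : Model n → Matrix (Fin n) (Fin n) ℝ) (y : Model n) : Prop where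
  smooth : ∀ i j, ContDiffAt ℝ ∞ (fun z => G z i j) y
  symm : ∀ᶠ z in 𝓝 y, (G z)ᵀ = G z
  det_ne_zero : (G y).det ≠ 0

theorem contDiffAt_det {y : Model n} {G : Model n → Matrix (Fin n) (Fin n) ℝ}
    (hG : ∀ i j, ContDiffAt ℝ ∞ (fun z => G z i j) y) :
    ContDiffAt ℝ ∞ (fun z => (G z).det) y := by
  simp only [det_apply]
  refine ContDiffAt.sum fun σ _ => ContDiffAt.const_smul _ (contDiffAt_prod fun i _ => hG _ _)

/-- Cramer's rule: the entries are polynomials in those of `G` divided by the determinant. -/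
theorem contDiffAt_inv {y : Model n} {G : Model n → Matrix (Fin n) (Fin n) ℝ}
    (hG : ∀ i j, ContDiffAt ℝ ∞ (fun z => G z i j) y) (hdet : (G y).det ≠ 0) (i j : Fin n) :
    ContDiffAt ℝ ∞ (fun z => (G z)⁻¹ i j) y := by
  have e : (fun z => (G z)⁻¹ i j) = fun z => ((G z).det)⁻¹ * (G z).adjugate i j := by
    ext z
    rw [inv_def, Ring.inverse_eq_inv', Matrix.smul_apply, smul_eq_mul]
  rw [e]
  refine ((contDiffAt_det hG).inv hdet).mul ?_
  simp only [adjugate_apply]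
  refine contDiffAt_det fun a b => ?_
  by_cases h : a = j
  · subst h
    simp only [updateRow_self]
    exact contDiffAt_const
  · simp only [updateRow_ne h]
    exact hG a b

theorem isGerm_one_apply (y : Model n) (i j : Fin n) :
    IsGerm (y := y) (fun _ => (1 : Matrix (Fin n) (Fin n) ℝ) i j)
      ((1 : Matrix (Fin n) (Fin n) (SmoothGerm y)) i j) := by
  by_cases h : i = j
  · subst h; simpa using IsGerm.one y
  · simpa [h] using IsGerm.zero y

namespace IsMetricAt

variable {G : Model n → Matrix (Fin n) (Fin n) ℝ} {y : Model n}

theorem contDiffAt_gUp (hG : IsMetricAt G y) (i j : Fin n) : ContDiffAt ℝ ∞ (gUp G i j) y :=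
  contDiffAt_inv hG.smooth hG.det_ne_zero i j

theorem eventually_det_ne_zero (hG : IsMetricAt G y) : ∀ᶠ z in 𝓝 y, (G z).det ≠ 0 :=
  (contDiffAt_det hG.smooth).continuousAt.eventually_ne hG.det_ne_zero

/-- The germ of a metric. -/
def germ (hG : IsMetricAt G y) : (germCoord y).Metric where
  g := of fun i j => Ideal.Quotient.mk (nullIdeal y) ⟨fun z => G z i j, hG.smooth i j⟩
  h := of fun i j => Ideal.Quotient.mk (nullIdeal y) ⟨gUp G i j, hG.contDiffAt_gUp i j⟩
  g_symm := by
    ext i j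
    refine (IsGerm.eq_iff (y := y) ⟨hG.smooth j i, rfl⟩ ⟨hG.smooth i j, rfl⟩).mpr ?_
    filter_upwards [hG.symm] with z hz
    exact congrFun (congrFun hz i) j
  h_symm := by
    ext i j
    refine (IsGerm.eq_iff (y := y) ⟨hG.contDiffAt_gUp j i, rfl⟩
      ⟨hG.contDiffAt_gUp i j, rfl⟩).mpr ?_
    filter_upwards [hG.symm] with z hz
    have e : ((G z)⁻¹)ᵀ = (G z)⁻¹ := by rw [transpose_nonsing_inv, hz]
    exact congrFun (congrFun e i) j
  g_mul_h := by
    ext i j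
    rw [Matrix.mul_apply]
    refine (IsGerm.eq_iff (IsGerm.sum fun k _ => IsGerm.mul (y := y) ⟨hG.smooth i k, rfl⟩
      ⟨hG.contDiffAt_gUp k j, rfl⟩)
      (isGerm_one_apply y i j)).mpr ?_
    filter_upwards [hG.eventually_det_ne_zero] with z hz
    rw [← mul_nonsing_inv (G z) hz.isUnit, Matrix.mul_apply]
    rfl

theorem isGerm_g (hG : IsMetricAt G y) (i j : Fin n) :
    IsGerm (fun z => G z i j) (hG.germ.g i j) := ⟨hG.smooth i j, rfl⟩

theorem isGerm_h (hG : IsMetricAt G y) (i j : Fin n) :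
    IsGerm (gUp G i j) (hG.germ.h i j) := ⟨hG.contDiffAt_gUp i j, rfl⟩

theorem isGerm_chr (hG : IsMetricAt G y) (k i j : Fin n) :
    IsGerm (christoffel G k i j) (hG.germ.chr k i j) := by
  rw [CoordAlgebra.Metric.chr, Algebra.smul_def]
  exact (IsGerm.const y _).mul (IsGerm.sum fun l _ => (hG.isGerm_h k l).mul
    ((((hG.isGerm_g j l).d i).add ((hG.isGerm_g i l).d j)).sub ((hG.isGerm_g i j).d l)))

theorem isGerm_riem (hG : IsMetricAt G y) (l k i j : Fin n) :
    IsGerm (riemann G l k i j) (hG.germ.riem l k i j) :=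
  (((hG.isGerm_chr l j k).d i).sub ((hG.isGerm_chr l i k).d j)).add
    (IsGerm.sum fun a _ => ((hG.isGerm_chr l i a).mul (hG.isGerm_chr a j k)).sub
      ((hG.isGerm_chr l j a).mul (hG.isGerm_chr a i k)))

theorem isGerm_ric (hG : IsMetricAt G y) (k j : Fin n) :
    IsGerm (ricci G k j) (hG.germ.ric k j) :=
  IsGerm.sum fun l _ => hG.isGerm_riem l k j l

theorem isGerm_ricUp (hG : IsMetricAt G y) (i j : Fin n) :
    IsGerm (ricciUp G i j) (hG.germ.ricUp i j) :=
  IsGerm.sum fun a _ => IsGerm.sum fun b _ =>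
    ((hG.isGerm_h i a).mul (hG.isGerm_h j b)).mul (hG.isGerm_ric a b)

theorem isGerm_scal (hG : IsMetricAt G y) : IsGerm (scalarCurv G) hG.germ.scal :=
  IsGerm.sum fun i _ => IsGerm.sum fun j _ => (hG.isGerm_h i j).mul (hG.isGerm_ric i j)

theorem isGerm_ricSq (hG : IsMetricAt G y) : IsGerm (ricciSq G) hG.germ.ricSq :=
  IsGerm.sum fun i _ => IsGerm.sum fun j _ => (hG.isGerm_ricUp i j).mul (hG.isGerm_ric i j)

theorem isGerm_div (hG : IsMetricAt G y) {V : Fin n → Model n → ℝ} {W : Fin n → SmoothGerm y}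
    (h : ∀ j, IsGerm (V j) (W j)) : IsGerm (divergence G V) (hG.germ.div W) :=
  IsGerm.sum fun j _ => ((h j).d j).add
    (IsGerm.sum fun k _ => (hG.isGerm_chr j j k).mul (h k))

theorem isGerm_lap (hG : IsMetricAt G y) {f : Model n → ℝ} {a : SmoothGerm y} (h : IsGerm f a) :
    IsGerm (laplace G f) (hG.germ.lap a) :=
  hG.isGerm_div fun j => IsGerm.sum fun i _ => (hG.isGerm_h i j).mul (h.d i)

/-- The bridge between the two calculi: with `IsGerm.eval_eq`, identities of germs become identities
of values at `y`. -/
theorem isGerm_quartic (hG : IsMetricAt G y) {f : Model n → ℝ} {a : SmoothGerm y}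
    (h : IsGerm f a) : IsGerm (coordQuartic G f) (hG.germ.quartic a) :=
  ((hG.isGerm_lap (hG.isGerm_lap h)).add
    (hG.isGerm_div fun j => IsGerm.sum fun i _ => (((IsGerm.const y _).mul
      (hG.isGerm_ricUp i j)).add ((IsGerm.const y _).mul
        ((hG.isGerm_h i j).mul hG.isGerm_scal))).mul (h.d i))).add
    (((((IsGerm.const y _).mul (hG.isGerm_lap hG.isGerm_scal)).sub
      ((IsGerm.const y _).mul hG.isGerm_ricSq)).add
        ((IsGerm.const y _).mul (hG.isGerm_scal.pow 2))).mul h)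

theorem coordQuartic_congr (hG : IsMetricAt G y) {f f' : Model n → ℝ}
    (hf : ContDiffAt ℝ ∞ f y) (h : f' =ᶠ[𝓝 y] f) : coordQuartic G f' y = coordQuartic G f y := by
  obtain ⟨a, ha⟩ := exists_germ hf
  rw [← (hG.isGerm_quartic ha).eval_eq, ← (hG.isGerm_quartic (ha.congr h)).eval_eq]

end IsMetricAt

theorem IsGerm.dv_eq {y : Model n} {f h k : Model n → ℝ} {a b c : SmoothGerm y} (ha : IsGerm f a)
    (hb : IsGerm h b) (hc : IsGerm k c) (e : ∀ᶠ z in 𝓝 y, ∀ i, Paneitz.pd i f z = k z * Paneitz.pd i h z) :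
    (germCoord y).dv a = c • (germCoord y).dv b := by
  ext i
  refine ((ha.d i).eq_iff (hc.mul (hb.d i))).mpr ?_
  filter_upwards [e] with z hz using hz i

/-- The conformal covariance of the quartic operator in coordinates. -/
theorem coordQuartic_conformal (hn : 2 < n) {y : Model n}
    {G₁ G₂ : Model n → Matrix (Fin n) (Fin n) ℝ} (h₁ : IsMetricAt G₁ y) (h₂ : IsMetricAt G₂ y)
    {p : Model n → ℝ} (hp : ContDiffAt ℝ ∞ p y) (hpos : 0 < p y)
    (h : ∀ᶠ z in 𝓝 y, G₁ z = (p z ^ 2) • G₂ z) {f : Model n → ℝ} (hf : ContDiffAt ℝ ∞ f y) :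
    p y ^ (((n : ℝ) + 4) / 2) * coordQuartic G₁ f y
      = coordQuartic G₂ (fun z => p z ^ (((n : ℝ) - 4) / 2) * f z) y := by
  have hpos' : ∀ᶠ z in 𝓝 y, 0 < p z := hp.continuousAt.eventually (lt_mem_nhds hpos)
  -- The conformal data are `s = log p`, `w = p ^ 2`, its inverse `v`, and the weight `u = p ^ ((n -
  -- 4) / 2)`.
  obtain ⟨s, hs⟩ := exists_germ (hp.log hpos.ne')
  obtain ⟨w, hw⟩ := exists_germ (hp.pow 2)
  obtain ⟨v, hv⟩ := exists_germ ((hp.pow 2).inv (pow_ne_zero 2 hpos.ne'))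
  obtain ⟨u, hu⟩ := exists_germ (hp.rpow_const_of_ne (p := ((n : ℝ) - 4) / 2) hpos.ne')
  obtain ⟨a, ha⟩ := exists_germ hf
  have hd := eventually_differentiableAt hp
  have hlog : ∀ᶠ z in 𝓝 y, ∀ i, pd i (fun z => Real.log (p z)) z = (p z)⁻¹ * pd i p z := by
    filter_upwards [hpos', hd] with z hz hdz i
    rw [pd, (hdz.hasFDerivAt.log hz.ne').fderiv]
    rfl
  have hc : h₁.germ.IsConformal h₂.germ s w v := by
    refine ⟨?_, ?_, ?_, ?_⟩
    · ext i j
      refine ((h₁.isGerm_g i j).eq_iff (hw.mul (h₂.isGerm_g i j))).mpr ?_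
      filter_upwards [h] with z hz
      rw [hz]; rfl
    · ext i j
      refine ((h₁.isGerm_h i j).eq_iff (hv.mul (h₂.isGerm_h i j))).mpr ?_
      filter_upwards [h, hpos', h₂.eventually_det_ne_zero] with z hz hz' hdet
      have e : (G₁ z)⁻¹ = (p z ^ 2)⁻¹ • (G₂ z)⁻¹ := by
        refine inv_eq_right_inv ?_
        rw [hz, Matrix.smul_mul, Matrix.mul_smul, smul_smul,
          mul_inv_cancel₀ (pow_ne_zero 2 hz'.ne'), one_smul, mul_nonsing_inv _ hdet.isUnit]
      exact congrFun (congrFun e i) j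
    · refine ((hv.mul hw).eq_iff (IsGerm.one y)).mpr ?_
      filter_upwards [hpos'] with z hz
      exact inv_mul_cancel₀ (pow_ne_zero 2 hz.ne')
    · have h2 := ((IsGerm.const y 2).mul hw)
      rw [map_ofNat] at h2
      refine hw.dv_eq hs h2 ?_
      filter_upwards [hlog, hpos', hd] with z hz hz' hdz i
      rw [hz, pd, (hdz.hasFDerivAt.pow 2).fderiv]
      simp only [pd, _root_.smul_apply, smul_eq_mul, nsmul_eq_mul]
      field_simp
      norm_num
      ring
  have hu' : (germCoord y).dv u
      = (algebraMap ℝ (SmoothGerm y) (((n : ℝ) - 4) / 2) * u) • (germCoord y).dv s := by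
    refine hu.dv_eq hs ((IsGerm.const y _).mul hu) ?_
    filter_upwards [hlog, hpos', hd] with z hz hz' hdz i
    rw [hz, pd, (hdz.hasFDerivAt.rpow_const (Or.inl hz'.ne')).fderiv]
    simp only [pd, _root_.smul_apply, smul_eq_mul]
    rw [Real.rpow_sub_one hz'.ne']
    ring
  have key := hc.quartic_eq hn hu' a (germEval y)
  rw [(h₂.isGerm_quartic (hu.mul ha)).eval_eq, map_mul, map_mul, map_pow,
    (h₁.isGerm_quartic ha).eval_eq, hu.eval_eq, hw.eval_eq] at key
  rw [← key]
  congr 1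
  -- The exponents add up: `(n - 4) / 2 + 4 = (n + 4) / 2`.
  rw [← pow_mul, ← Real.rpow_natCast, ← Real.rpow_add hpos]
  congr 1
  push_cast
  ring

theorem model_eq_sum (v : Model n) : v = ∑ k, v k • EuclideanSpace.single k (1 : ℝ) := by
  ext j
  simp [Finset.sum_apply, Pi.single_apply]

theorem pd_apply {z : Model n} {ψ : Model n → Model n} (hψ : DifferentiableAt ℝ ψ z)
    (i k : Fin n) : pd i (fun x => ψ x k) z = fderiv ℝ ψ z (EuclideanSpace.single i 1) k := by
  have := ((EuclideanSpace.proj k : Model n →L[ℝ] ℝ).hasFDerivAt.comp z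
    hψ.hasFDerivAt).fderiv
  exact congrArg (fun L => L (EuclideanSpace.single i 1)) this

theorem pd_comp {z : Model n} {ψ : Model n → Model n} {f : Model n → ℝ}
    (hf : DifferentiableAt ℝ f (ψ z)) (hψ : DifferentiableAt ℝ ψ z) (i : Fin n) :
    pd i (f ∘ ψ) z = ∑ k, pd i (fun x => ψ x k) z * pd k f (ψ z) := by
  rw [pd, fderiv_comp z hf hψ, ContinuousLinearMap.comp_apply,
    model_eq_sum (fderiv ℝ ψ z (EuclideanSpace.single i 1)), map_sum]
  refine Finset.sum_congr rfl fun k _ => ?_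
  rw [map_smul, pd_apply hψ, smul_eq_mul, pd]

/-- The invariance of the quartic operator under changes of coordinates. -/
theorem coordQuartic_comp {y : Model n} {ψ : Model n → Model n} (hψ : ContDiffAt ℝ ∞ ψ y)
    {G G' : Model n → Matrix (Fin n) (Fin n) ℝ} (hG : IsMetricAt G y) (hG' : IsMetricAt G' (ψ y))
    {J : Model n → Matrix (Fin n) (Fin n) ℝ} (hJ : ∀ z k i, J z k i = pd i (fun x => ψ x k) z)
    (hdet : (J y).det ≠ 0) (h : ∀ᶠ z in 𝓝 y, G z = (J z)ᵀ * G' (ψ z) * J z)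
    {f : Model n → ℝ} (hf : ContDiffAt ℝ ∞ f (ψ y)) :
    coordQuartic G (f ∘ ψ) y = coordQuartic G' f (ψ y) := by
  have hψk : ∀ k, ContDiffAt ℝ ∞ (fun x => ψ x k) y := fun k =>
    (contDiffAt_coord (y := ψ y) k).comp y hψ
  have hJs : ∀ k i, ContDiffAt ℝ ∞ (fun z => J z k i) y := by
    intro k i
    simp only [hJ]
    exact contDiffAt_pd (hψk k) i
  choose j hj using fun k i => exists_germ (hJs k i)
  choose k hk using fun a b => exists_germ (contDiffAt_inv hJs hdet a b)
  have hp : hG.germ.IsPullback hG'.germ (germComp hψ) (of j) (of k) := by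
    refine ⟨?_, ?_, ?_⟩
    · intro i b
      obtain ⟨β, hβ⟩ := exists_isGerm b
      refine (((hβ.comp hψ).d i).eq_iff
        (IsGerm.sum fun k _ => (hj k i).mul ((hβ.d k).comp hψ))).mpr ?_
      filter_upwards [hψ.continuousAt.eventually (eventually_differentiableAt hβ.1),
        ((hψ.of_le (m := 1) (by simp)).eventually (by simp))] with z hz hz'
      exact (pd_comp hz (hz'.differentiableAt (by simp)) i).trans
        (Finset.sum_congr rfl fun k _ => by rw [hJ]; rfl)
    · ext a b
      rw [Matrix.mul_apply]
      refine ((IsGerm.sum fun c _ => (hj a c).mul (hk c b)).eq_iff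
        (isGerm_one_apply y a b)).mpr ?_
      filter_upwards [(contDiffAt_det hJs).continuousAt.eventually_ne hdet] with z hz
      rw [← mul_nonsing_inv (J z) hz.isUnit, Matrix.mul_apply]
    · ext a b
      simp only [Matrix.mul_apply]
      refine ((hG.isGerm_g a b).eq_iff (IsGerm.sum fun c _ => (IsGerm.sum fun c' _ =>
        (hj c' a).mul ((hG'.isGerm_g c' c).comp hψ)).mul (hj c b))).mpr ?_
      filter_upwards [h] with z hz
      rw [hz, Matrix.mul_apply]
      simp only [Matrix.mul_apply]
      rfl
  obtain ⟨a, ha⟩ := exists_germ hf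
  have key := congrArg (germEval y) (hp.quartic_eq a)
  rwa [(hG.isGerm_quartic (ha.comp hψ)).eval_eq,
    ((hG'.isGerm_quartic ha).comp hψ).eval_eq] at key

end Paneitz
end

/-! ### Charts, rescaling and conformal diffeomorphisms on the manifold. -/

noncomputable section

namespace Paneitz

open Filter Topology Matrix

variable {n : ℕ}

/-- Smoothness of the conformal factor is automatic: near `y` it is the square root of a quotient of
components, for an entry of `G₂` that does not vanish at `y`. -/
theorem contDiffAt_factor (hn : 0 < n) {y : Model n} {G₁ G₂ : Model n → Matrix (Fin n) (Fin n) ℝ}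
    (h₁ : IsMetricAt G₁ y) (h₂ : IsMetricAt G₂ y) {p : Model n → ℝ} (hpos : ∀ z, 0 < p z)
    (h : ∀ᶠ z in 𝓝 y, G₁ z = (p z ^ 2) • G₂ z) : ContDiffAt ℝ ∞ p y := by
  obtain ⟨i, j, hij⟩ : ∃ i j, G₂ y i j ≠ 0 := by
    by_contra! hc
    have : Nonempty (Fin n) := ⟨⟨0, hn⟩⟩
    exact h₂.det_ne_zero (by rw [show G₂ y = 0 from Matrix.ext hc, det_zero])
  have hne := (h₂.smooth i j).continuousAt.eventually_ne hij
  have e : p =ᶠ[𝓝 y] fun z => √(G₁ z i j / G₂ z i j) := by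
    filter_upwards [h, hne] with z hz hz'
    rw [hz, Matrix.smul_apply, smul_eq_mul, mul_div_cancel_right₀ _ hz', Real.sqrt_sq (hpos z).le]
  refine ContDiffAt.congr_of_eventuallyEq (((h₁.smooth i j).div (h₂.smooth i j) hij).sqrt ?_) e
  rw [Pi.div_apply, h.self_of_nhds, Matrix.smul_apply, smul_eq_mul, mul_div_cancel_right₀ _ hij]
  exact pow_ne_zero 2 (hpos y).ne'

/-- Scaling by a real constant commutes with `fderiv` even where the derivative does not exist, so
no regularity is required. -/
theorem divergence_const_mul (G : Model n → Matrix (Fin n) (Fin n) ℝ) (c : ℝ)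
    (V : Fin n → Model n → ℝ) (y : Model n) :
    divergence G (fun j z => c * V j z) y = c * divergence G V y := by
  have e : ∀ j, pd j (fun z => c * V j z) y = c * pd j (V j) y := by
    intro j
    have h := fderiv_const_smul_field (𝕜 := ℝ) c (f := V j)
    exact congrArg (fun L => L y (EuclideanSpace.single j 1)) h
  simp only [divergence, e, Finset.mul_sum, mul_add]
  refine Finset.sum_congr rfl fun j _ => ?_
  congr 1
  exact Finset.sum_congr rfl fun k _ => by ring

/-- At `n = 4` the coefficients are `-2` and `2 / 3`, and the terms of order zero carry a factor `n
- 4`. -/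
theorem coordQuartic_eq_four (hn : n = 4) (G : Model n → Matrix (Fin n) (Fin n) ℝ)
    (f : Model n → ℝ) (y : Model n) : coordQuartic G f y = coordQuarticFour G f y := by
  have h4 : (n : ℝ) = 4 := by rw [hn]; norm_num
  have e : (fun (j : Fin n) (z : Model n) => ∑ i,
        (-(4 / ((n : ℝ) - 2)) * ricciUp G i j z
          + ((n : ℝ) ^ 2 - 4 * n + 8) / (2 * ((n : ℝ) - 1) * ((n : ℝ) - 2))
            * (gUp G i j z * scalarCurv G z)) * pd i f z)
      = fun j z => (-2) * ∑ i,
        (ricciUp G i j z - 1 / 3 * (gUp G i j z * scalarCurv G z)) * pd i f z := by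
    ext j z
    rw [Finset.mul_sum]
    refine Finset.sum_congr rfl fun i _ => ?_
    rw [h4]
    ring
  rw [coordQuartic, e, divergence_const_mul, coordQuarticFour, h4]
  ring

theorem apply_sum_smul (b : Model n →L[ℝ] Model n →L[ℝ] ℝ) (s t : Fin n → ℝ)
    (v : Fin n → Model n) :
    b (∑ k, s k • v k) (∑ k, t k • v k) = ∑ k, (∑ l, s l * b (v l) (v k)) * t k := by
  simp only [map_sum, map_smul, _root_.sum_apply, _root_.smul_apply, smul_eq_mul]
  exact Finset.sum_congr rfl fun k _ => mul_comm _ _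

/-- A vector in the kernel of the Gram matrix has an image under `L` orthogonal to the whole range
of `L`. Surjectivity and nondegeneracy make the image zero, and injectivity the vector. -/
theorem det_gram_ne_zero (b : Model n →L[ℝ] Model n →L[ℝ] ℝ)
    (hb : ∀ v, (∀ w, b v w = 0) → v = 0) (L : Model n →L[ℝ] Model n)
    (hinj : Function.Injective L) (hsurj : Function.Surjective L) :
    (of fun i j : Fin n => b (L (EuclideanSpace.single i 1)) (L (EuclideanSpace.single j 1))).det
      ≠ 0 := by
  intro hdet
  obtain ⟨v, hv, hGv⟩ := exists_vecMul_eq_zero_iff.mpr hdet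
  have h0 : L (WithLp.toLp 2 v) = 0 := by
    refine hb _ fun w => ?_
    obtain ⟨w, rfl⟩ := hsurj w
    rw [model_eq_sum w, map_sum, map_sum]
    refine Finset.sum_eq_zero fun j _ => ?_
    have h1 := congrFun hGv j
    rw [map_smul, map_smul, model_eq_sum (WithLp.toLp 2 v), map_sum, map_sum,
      _root_.sum_apply]
    simp only [map_smul, _root_.smul_apply]
    have h2 : ∑ i, v i • b (L (EuclideanSpace.single i 1)) (L (EuclideanSpace.single j 1)) = 0 := h1
    rw [h2, smul_zero]
  have h2 : (WithLp.toLp 2 v : Model n) = 0 := hinj (h0.trans (map_zero L).symm)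
  apply hv
  ext k
  exact congrArg (fun w : Model n => w k) h2

/-- Near `z` the map `F ∘ e.symm` equals `e'.symm` after the local expression of `F`. The chain rule
on both sides brings out the Jacobian matrix. -/
theorem mfderiv_coordVec {M : Type*} [TopologicalSpace M] [ChartedSpace (Model n) M]
    (F : M ≃ₘ⟮𝓘(ℝ, Model n), 𝓘(ℝ, Model n)⟯ M)
    {e e' : OpenPartialHomeomorph M (Model n)}
    (he : e.MDifferentiable 𝓘(ℝ, Model n) 𝓘(ℝ, Model n))
    (he' : e'.MDifferentiable 𝓘(ℝ, Model n) 𝓘(ℝ, Model n)) {z : Model n} (hz : z ∈ e.target)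
    (hz' : F (e.symm z) ∈ e'.source) (i : Fin n) :
    (mfderiv 𝓘(ℝ, Model n) 𝓘(ℝ, Model n) F (e.symm z) (coordVec e i z) : Model n)
      = ∑ k, pd i (fun x => (e' (F (e.symm x))) k) z •
          (coordVec e' k (e' (F (e.symm z))) : Model n) := by
  have hF : MDifferentiableAt 𝓘(ℝ, Model n) 𝓘(ℝ, Model n) F (e.symm z) :=
    F.contMDiff.mdifferentiable (by simp) _
  have hes : MDifferentiableAt 𝓘(ℝ, Model n) 𝓘(ℝ, Model n) e.symm z :=
    he.mdifferentiableAt_symm hz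
  have h1 := mfderiv_comp z hF hes
  have hψ : MDifferentiableAt 𝓘(ℝ, Model n) 𝓘(ℝ, Model n) (fun x => e' (F (e.symm x))) z :=
    (he'.mdifferentiableAt hz').comp z (hF.comp z hes)
  have h2 := mfderiv_comp z (he'.mdifferentiableAt_symm (e'.map_source hz')) hψ
  have h3 : (F ∘ e.symm : Model n → M) =ᶠ[𝓝 z] e'.symm ∘ fun x => e' (F (e.symm x)) := by
    have hc : ContinuousAt (fun x => F (e.symm x)) z := (hF.comp z hes).continuousAt
    filter_upwards [hc.eventually (e'.open_source.mem_nhds hz')] with x hx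
    exact (e'.left_inv hx).symm
  have h4 := h3.mfderiv_eq (I := 𝓘(ℝ, Model n)) (I' := 𝓘(ℝ, Model n))
  rw [mfderiv_eq_fderiv] at h2
  have hd : DifferentiableAt ℝ (fun x => e' (F (e.symm x))) z := hψ.differentiableAt
  set L : Model n →L[ℝ] Model n :=
    mfderiv 𝓘(ℝ, Model n) 𝓘(ℝ, Model n) e'.symm (e' (F (e.symm z))) with hL
  have h5 : (mfderiv 𝓘(ℝ, Model n) 𝓘(ℝ, Model n) F (e.symm z) (coordVec e i z) : Model n)
      = L (fderiv ℝ (fun x => e' (F (e.symm x))) z (EuclideanSpace.single i 1)) := by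
    have h6 := h1.symm.trans (h4.trans h2)
    exact congrArg (fun A : Model n →L[ℝ] Model n => A (EuclideanSpace.single i 1)) h6
  rw [h5, model_eq_sum (fderiv ℝ (fun x => e' (F (e.symm x))) z (EuclideanSpace.single i 1)),
    map_sum]
  refine Finset.sum_congr rfl fun k _ => ?_
  rw [map_smul, pd_apply hd]
  rfl

section Manifold

variable {M : Type*} [TopologicalSpace M] [ChartedSpace (Model n) M]
  [IsManifold 𝓘(ℝ, Model n) ∞ M]

theorem contMDiffAt_coordVec (x : M) (i : Fin n) :
    ContMDiffAt 𝓘(ℝ, Model n) (𝓘(ℝ, Model n).prod 𝓘(ℝ, Model n)) ∞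
      (fun z => Bundle.TotalSpace.mk' (Model n) (E := (TangentSpace 𝓘(ℝ, Model n) : M → Type))
        ((chartAt (Model n) x).symm z) (coordVec (chartAt (Model n) x) i z))
      (chartAt (Model n) x x) := by
  have hs : ContMDiffAt 𝓘(ℝ, Model n) 𝓘(ℝ, Model n) ∞ (chartAt (Model n) x).symm
      (chartAt (Model n) x x) :=
    (contMDiffOn_chart_symm (I := 𝓘(ℝ, Model n)) (n := ∞)).contMDiffAt
      ((chartAt (Model n) x).open_target.mem_nhds (mem_chart_target _ x))
  have hd := hs.mfderiv_const (m := ∞) (by simp)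
  have hv : ContMDiffAt 𝓘(ℝ, Model n) (𝓘(ℝ, Model n).prod 𝓘(ℝ, Model n)) ∞
      (fun z : Model n => Bundle.TotalSpace.mk' (Model n)
        (E := (TangentSpace 𝓘(ℝ, Model n) : Model n → Type)) z
        (EuclideanSpace.single i (1 : ℝ) : Model n)) (chartAt (Model n) x x) :=
    contMDiffAt_vectorSpace_iff_contDiffAt.mpr contDiffAt_const
  exact ContMDiffAt.clm_apply_of_inCoordinates hd hv hs

theorem PseudoRiemannianMetric.contDiffAt_components (g : PseudoRiemannianMetric n M) (x : M)
    (i j : Fin n) : ContDiffAt ℝ ∞ (fun z => g.components (chartAt (Model n) x) z i j)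
      (chartAt (Model n) x x) := by
  have hs : ContMDiffAt 𝓘(ℝ, Model n) 𝓘(ℝ, Model n) ∞ (chartAt (Model n) x).symm
      (chartAt (Model n) x x) :=
    (contMDiffOn_chart_symm (I := 𝓘(ℝ, Model n)) (n := ∞)).contMDiffAt
      ((chartAt (Model n) x).open_target.mem_nhds (mem_chart_target _ x))
  have : ContMDiffAt 𝓘(ℝ, Model n) (𝓘(ℝ, Model n).prod 𝓘(ℝ)) ∞
      (fun z => Bundle.TotalSpace.mk' ℝ (E := Bundle.Trivial M ℝ) ((chartAt (Model n) x).symm z)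
        (g.inner ((chartAt (Model n) x).symm z) (coordVec (chartAt (Model n) x) i z)
          (coordVec (chartAt (Model n) x) j z))) (chartAt (Model n) x x) := by
    apply ContMDiffAt.clm_bundle_apply₂ (F₁ := Model n) (F₂ := Model n)
    · exact ContMDiffAt.comp (chartAt (Model n) x x) g.contMDiff.contMDiffAt hs
    · exact contMDiffAt_coordVec x i
    · exact contMDiffAt_coordVec x j
  simp only [Bundle.contMDiffAt_totalSpace] at this
  exact this.2.contDiffAt

theorem PseudoRiemannianMetric.isMetricAt (g : PseudoRiemannianMetric n M) (x : M) :
    IsMetricAt (g.components (chartAt (Model n) x)) (chartAt (Model n) x x) := by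
  refine ⟨g.contDiffAt_components x, .of_forall fun z => ?_, fun hdet => ?_⟩
  · ext i j
    exact g.symm _ _ _
  · have hmd : (chartAt (Model n) x).MDifferentiable 𝓘(ℝ, Model n) 𝓘(ℝ, Model n) :=
      mdifferentiable_chart x
    have hy : chartAt (Model n) x x ∈ (chartAt (Model n) x).symm.source := mem_chart_target _ x
    exact det_gram_ne_zero (g.inner _) (g.nondegenerate _) (mfderiv 𝓘(ℝ, Model n) 𝓘(ℝ, Model n)
      (chartAt (Model n) x).symm (chartAt (Model n) x x)) (hmd.symm.mfderiv_injective hy)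
      (hmd.symm.mfderiv_surjective hy) hdet

theorem contDiffAt_comp_chart_symm {φ : M → ℝ} (hφ : ContMDiff 𝓘(ℝ, Model n) 𝓘(ℝ) ∞ φ) (x : M) :
    ContDiffAt ℝ ∞ (φ ∘ (chartAt (Model n) x).symm) (chartAt (Model n) x x) := by
  have hs : ContMDiffAt 𝓘(ℝ, Model n) 𝓘(ℝ, Model n) ∞ (chartAt (Model n) x).symm
      (chartAt (Model n) x x) :=
    (contMDiffOn_chart_symm (I := 𝓘(ℝ, Model n)) (n := ∞)).contMDiffAt
      ((chartAt (Model n) x).open_target.mem_nhds (mem_chart_target _ x))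
  exact (hφ.contMDiffAt.comp _ hs).contDiffAt

/-- The conformal covariance of the quartic operator. -/
theorem quartic_rescaling (hn : 2 < n) {g₁ g₂ : PseudoRiemannianMetric n M} {p : M → ℝ}
    (hp : ∀ x, 0 < p x) (hg : IsRescaling p g₁ g₂) {φ : M → ℝ}
    (hφ : ContMDiff 𝓘(ℝ, Model n) 𝓘(ℝ) ∞ φ) (x : M) :
    p x ^ (((n : ℝ) + 4) / 2) * quartic g₁ φ x
      = quartic g₂ (fun y => p y ^ (((n : ℝ) - 4) / 2) * φ y) x := by
  have h : ∀ z, g₁.components (chartAt (Model n) x) z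
      = ((p ∘ (chartAt (Model n) x).symm) z ^ 2) • g₂.components (chartAt (Model n) x) z := by
    intro z; ext i j; exact hg _ _ _
  have hps := contDiffAt_factor (by omega) (g₁.isMetricAt x) (g₂.isMetricAt x)
    (p := p ∘ (chartAt (Model n) x).symm) (fun z => hp _) (.of_forall h)
  have key := coordQuartic_conformal hn (g₁.isMetricAt x) (g₂.isMetricAt x) hps (hp _)
    (.of_forall h) (contDiffAt_comp_chart_symm hφ x)
  have e : (p ∘ (chartAt (Model n) x).symm) (chartAt (Model n) x x) = p x := by
    rw [Function.comp_apply, (chartAt (Model n) x).left_inv (mem_chart_source _ x)]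
  rw [e] at key
  exact key

/-- The weight on the function is `p ^ 0`, and the factor outside the operator is positive. -/
theorem kernel_eq_of_rescaling (hn : n = 4) {g₁ g₂ : PseudoRiemannianMetric n M} {p : M → ℝ}
    (hp : ∀ x, 0 < p x) (hg : IsRescaling p g₁ g₂) : kernel g₁ = kernel g₂ := by
  have h4 : (n : ℝ) = 4 := by rw [hn]; norm_num
  ext φ
  refine and_congr_right fun hφ => forall_congr' fun x => ?_
  have h := quartic_rescaling (by omega) hp hg hφ x
  have e : (fun y => p y ^ (((n : ℝ) - 4) / 2) * φ y) = φ := by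
    ext y; simp [h4]
  rw [e] at h
  rw [← h, mul_eq_zero, or_iff_right (Real.rpow_pos_of_pos (hp x) _).ne']

theorem conformalGroup_eq_of_rescaling {g₁ g₂ : PseudoRiemannianMetric n M} {p : M → ℝ}
    (hp : ∀ x, 0 < p x) (hg : IsRescaling p g₁ g₂) : conformalGroup g₁ = conformalGroup g₂ := by
  ext F
  constructor
  · rintro ⟨q, hq, h⟩
    -- The hypothesis reads `p (F x) ^ 2 * F^* g₂ = q x ^ 2 * p x ^ 2 * g₂`.
    refine ⟨fun x => q x * p x / p (F x), fun x => div_pos (mul_pos (hq x) (hp x)) (hp _), ?_⟩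
    intro x v w
    have h1 := h x v w
    rw [hg, hg] at h1
    rw [div_pow, div_mul_eq_mul_div, eq_div_iff (pow_ne_zero 2 (hp _).ne'), mul_comm, h1]
    ring
  · rintro ⟨q, hq, h⟩
    refine ⟨fun x => q x * p (F x) / p x, fun x => div_pos (mul_pos (hq x) (hp _)) (hp _), ?_⟩
    intro x v w
    have h1 := h x v w
    rw [hg, hg, h1]
    have := (hp x).ne'
    field_simp

/-- In dimension four, conformal diffeomorphisms intertwine the quartic operator with itself up to
a positive factor. -/
theorem quartic_comp_conformal (hn : n = 4) {g : PseudoRiemannianMetric n M}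
    {F : M ≃ₘ⟮𝓘(ℝ, Model n), 𝓘(ℝ, Model n)⟯ M} {q : M → ℝ} (hq : ∀ x, 0 < q x)
    (hF : ∀ (x : M) (v w : TangentSpace 𝓘(ℝ, Model n) x),
      g.inner (F x) (mfderiv 𝓘(ℝ, Model n) 𝓘(ℝ, Model n) F x v)
        (mfderiv 𝓘(ℝ, Model n) 𝓘(ℝ, Model n) F x w) = q x ^ 2 * g.inner x v w)
    {φ : M → ℝ} (hφ : ContMDiff 𝓘(ℝ, Model n) 𝓘(ℝ) ∞ φ) (x : M) :
    q x ^ (((n : ℝ) + 4) / 2) * quartic g φ (F x) = quartic g (φ ∘ F) x := by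
  have h4 : (n : ℝ) = 4 := by rw [hn]; norm_num
  set e := chartAt (Model n) x with he
  set e' := chartAt (Model n) (F x) with he'
  have hex : e.symm (e x) = x := e.left_inv (mem_chart_source _ x)
  have hmd : e.MDifferentiable 𝓘(ℝ, Model n) 𝓘(ℝ, Model n) := mdifferentiable_chart x
  have hmd' : e'.MDifferentiable 𝓘(ℝ, Model n) 𝓘(ℝ, Model n) := mdifferentiable_chart (F x)
  let ψ : Model n → Model n := fun z => e' (F (e.symm z))
  have hψy : ψ (e x) = e' (F x) := by simp only [ψ, hex]
  have hs : ContMDiffAt 𝓘(ℝ, Model n) 𝓘(ℝ, Model n) ∞ e.symm (e x) :=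
    (contMDiffOn_chart_symm (I := 𝓘(ℝ, Model n)) (n := ∞)).contMDiffAt
      (e.open_target.mem_nhds (mem_chart_target _ x))
  have hs' : ContMDiffAt 𝓘(ℝ, Model n) 𝓘(ℝ, Model n) ∞ e' (F (e.symm (e x))) := by
    rw [hex]
    exact (contMDiffOn_chart (I := 𝓘(ℝ, Model n)) (n := ∞)).contMDiffAt
      (e'.open_source.mem_nhds (mem_chart_source _ (F x)))
  have hFs : ContMDiffAt 𝓘(ℝ, Model n) 𝓘(ℝ, Model n) ∞ (fun z => F (e.symm z)) (e x) :=
    F.contMDiff.contMDiffAt.comp _ hs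
  have hψ : ContDiffAt ℝ ∞ ψ (e x) := (ContMDiffAt.comp (e x) hs' hFs).contDiffAt
  have hev : ∀ᶠ z in 𝓝 (e x), z ∈ e.target ∧ F (e.symm z) ∈ e'.source := by
    refine Eventually.and (e.open_target.mem_nhds (mem_chart_target _ x))
      (hFs.continuousAt.eventually (e'.open_source.mem_nhds ?_))
    change F (e.symm (e x)) ∈ e'.source
    rw [hex]; exact mem_chart_source _ (F x)
  have hG := g.isMetricAt x
  have hG' := g.isMetricAt (F x)
  rw [← he] at hG
  rw [← he', ← hψy] at hG'
  set G := g.components e with hGdef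
  set G' := g.components e' with hGdef'
  let J : Model n → Matrix (Fin n) (Fin n) ℝ := fun z => of fun k i => pd i (fun x => ψ x k) z
  -- The metric near `F x` pulled back by `ψ`. Coordinate invariance relates it to `G'`, conformal
  -- covariance to `G`.
  let G₃ : Model n → Matrix (Fin n) (Fin n) ℝ := fun z => (J z)ᵀ * G' (ψ z) * J z
  have hrel : ∀ᶠ z in 𝓝 (e x), G₃ z = ((q ∘ e.symm) z ^ 2) • G z := by
    filter_upwards [hev] with z hz
    ext i j
    have h1 := hF (e.symm z) (coordVec e i z) (coordVec e j z)
    have e1 := mfderiv_coordVec F hmd hmd' hz.1 hz.2 i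
    have e2 := mfderiv_coordVec F hmd hmd' hz.1 hz.2 j
    -- The base points `e'.symm (e' (F (e.symm z)))` and `F (e.symm z)` are equal but not
    -- definitionally, so the form is transported between them.
    have hb : ∀ {a b : M} (_ : a = b) (v w : Model n), (g.inner a : Model n →L[ℝ] Model n →L[ℝ] ℝ) v w
        = (g.inner b : Model n →L[ℝ] Model n →L[ℝ] ℝ) v w := by
      rintro a b rfl v w; rfl
    refine Eq.trans ?_ h1
    refine Eq.trans ?_ (hb (e'.left_inv hz.2) _ _)
    rw [e1, e2]
    simp only [G₃, Matrix.mul_apply, transpose_apply]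
    exact (apply_sum_smul (g.inner (e'.symm (e' (F (e.symm z))))) (fun k => J z k i)
      (fun k => J z k j) (fun k => coordVec e' k (e' (F (e.symm z))))).symm
  have hqpos : ∀ z, 0 < (q ∘ e.symm) z := fun z => hq _
  have hJs : ∀ k i, ContDiffAt ℝ ∞ (fun z => J z k i) (e x) := fun k i =>
    contDiffAt_pd ((contDiffAt_coord (y := ψ (e x)) k).comp (e x) hψ) i
  have hdet3 : (G₃ (e x)).det ≠ 0 := by
    rw [hrel.self_of_nhds, det_smul]
    exact mul_ne_zero (pow_ne_zero _ (pow_ne_zero 2 (hqpos _).ne')) hG.det_ne_zero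
  have hG₃ : IsMetricAt G₃ (e x) := by
    refine ⟨fun i j => ?_, ?_, hdet3⟩
    · simp only [G₃, Matrix.mul_apply, transpose_apply]
      exact ContDiffAt.sum fun k _ => (ContDiffAt.sum fun l _ =>
        (hJs l i).mul ((hG'.smooth l k).comp (e x) hψ)).mul (hJs k j)
    · filter_upwards [hrel, hG.symm] with z hz hz'
      rw [hz, transpose_smul, hz']
  -- The Jacobian is invertible because the pulled-back matrix is a nonzero multiple of the
  -- nondegenerate `G`.
  have hdetJ : (J (e x)).det ≠ 0 := by
    intro h0
    apply hdet3
    simp only [G₃, det_mul, h0, mul_zero]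
  have hqs := contDiffAt_factor (by omega) hG₃ hG hqpos hrel
  have hf : ContDiffAt ℝ ∞ (φ ∘ e'.symm) (ψ (e x)) := by
    rw [hψy]; exact contDiffAt_comp_chart_symm hφ (F x)
  have hcomp := coordQuartic_comp hψ hG₃ hG' (J := J) (fun _ _ _ => rfl) hdetJ
    (.of_forall fun _ => rfl) hf
  have hconf := coordQuartic_conformal (by omega) hG₃ hG hqs (hqpos _) hrel (hf.comp (e x) hψ)
  rw [hcomp, hψy] at hconf
  have e1 : (q ∘ e.symm) (e x) = q x := by rw [Function.comp_apply, hex]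
  rw [e1] at hconf
  refine hconf.trans ?_
  refine hG.coordQuartic_congr (contDiffAt_comp_chart_symm (hφ.comp F.contMDiff) x) ?_
  filter_upwards [hev] with z hz
  simp only [h4, sub_self, zero_div, Real.rpow_zero, one_mul, Function.comp_apply, ψ,
    e'.left_inv hz.2]
  rfl

/-- The intertwining relation for `F` gives both inclusions: applied to `φ ∘ F.symm` it shows that
the image stays in the kernel, and applied to `φ` that `φ ∘ F` is a preimage in the kernel. -/
theorem image_kernel_eq (hn : n = 4) {g : PseudoRiemannianMetric n M}
    {F : M ≃ₘ⟮𝓘(ℝ, Model n), 𝓘(ℝ, Model n)⟯ M} (hF : F ∈ conformalGroup g) :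
    (fun φ : M → ℝ => φ ∘ F.symm) '' kernel g = kernel g := by
  obtain ⟨q, hq, h⟩ := hF
  have hc : ∀ φ : M → ℝ, (φ ∘ F) ∘ F.symm = φ := fun φ => by
    ext x; simp
  have hc' : ∀ φ : M → ℝ, (φ ∘ F.symm) ∘ F = φ := fun φ => by
    ext x; simp
  apply Set.Subset.antisymm
  · rintro _ ⟨φ, ⟨hφ, h0⟩, rfl⟩
    have hs : ContMDiff 𝓘(ℝ, Model n) 𝓘(ℝ) ∞ (φ ∘ F.symm) := hφ.comp F.symm.contMDiff
    refine ⟨hs, fun x => ?_⟩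
    have key := quartic_comp_conformal hn hq h hs (F.symm x)
    rw [hc', h0, mul_eq_zero, or_iff_right (Real.rpow_pos_of_pos (hq _) _).ne'] at key
    simpa using key
  · rintro φ ⟨hφ, h0⟩
    refine ⟨φ ∘ F, ⟨hφ.comp F.contMDiff, fun x => ?_⟩, hc φ⟩
    rw [← quartic_comp_conformal hn hq h hφ, h0, mul_zero]

end Manifold
end Paneitz
end

theorem theorem1 (n : ℕ) (hn : 2 < n) (M : Type*) [TopologicalSpace M]
    [ChartedSpace (Paneitz.Model n) M] [IsManifold 𝓘(ℝ, Paneitz.Model n) ∞ M]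
    (g₁ g₂ : Paneitz.PseudoRiemannianMetric n M) (p : M → ℝ) (hp : ∀ x, 0 < p x)
    (hg : Paneitz.IsRescaling p g₁ g₂) :
    (∀ φ : M → ℝ, ContMDiff 𝓘(ℝ, Paneitz.Model n) 𝓘(ℝ) ∞ φ → ∀ x : M,
      p x ^ (((n : ℝ) + 4) / 2) * Paneitz.quartic g₁ φ x
        = Paneitz.quartic g₂ (fun y => p y ^ (((n : ℝ) - 4) / 2) * φ y) x) ∧
    (n = 4 →
      (∀ g : Paneitz.PseudoRiemannianMetric n M, ∀ φ : M → ℝ,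
        ContMDiff 𝓘(ℝ, Paneitz.Model n) 𝓘(ℝ) ∞ φ → ∀ x : M,
          Paneitz.quartic g φ x = Paneitz.quarticFour g φ x) ∧
      Paneitz.kernel g₁ = Paneitz.kernel g₂ ∧
      Paneitz.conformalGroup g₁ = Paneitz.conformalGroup g₂ ∧
      ∀ F ∈ Paneitz.conformalGroup g₁,
        (fun φ : M → ℝ => φ ∘ F.symm) '' Paneitz.kernel g₁ = Paneitz.kernel g₁) := by
  refine ⟨fun φ hφ x => Paneitz.quartic_rescaling hn hp hg hφ x, fun h4 =>
    ⟨fun g φ _ x => Paneitz.coordQuartic_eq_four h4 _ _ _,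
      Paneitz.kernel_eq_of_rescaling h4 hp hg, Paneitz.conformalGroup_eq_of_rescaling hp hg,
      fun F hF => Paneitz.image_kernel_eq h4 hF⟩⟩
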